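/- For a set $x$ let $[x]^2$ be the set of all two-element subsets of $x$, and let $\mathcal{S}(x)$ be the set of all permutations of $x$ (bijections from $x$ onto $x$). If $\mathfrak{a}=|x|$ is the cardinal of $x$, write $[\mathfrak{a}]^2=|[x]^2|$ and $\mathfrak{a}!=|\mathcal{S}(x)|$. For sets $y$, $z$, $|y|\leqslant|z|$ means that there is an injection from $y$ into $z$, and $|y|<|z|$ means that $|y|\leqslant|z|$ but not $|z|\leqslant|y|$. The theory $\mathsf{ZF}$ (Zermelo–Fraenkel set theory without the axiom of choice) proves that for every cardinal $\mathfrak{a}$, $[\mathfrak{a}]^2<\mathfrak{a}!$. That is, in every model of the first-order theory $\mathsf{ZF}$ it is true that for every set $x$ there is an injection from $[x]^2$ into $\mathcal{S}(x)$, and there is no injection from $\mathcal{S}(x)$ into $[x]^2$. -/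

import Mathlib

namespace SetTheoryZF

open FirstOrder FirstOrder.Language

/-! ### The language of set theory -/

/-- The relation symbols of set theory: a single binary one. -/
inductive SetRel : ℕ → Type
  | mem : SetRel 2

/-- The first-order language of set theory, with membership as its only non-logical symbol. -/
def setLang : FirstOrder.Language.{0, 0} := ⟨fun _ => Empty, SetRel⟩

/-- The membership symbol. -/
abbrev memSymbol : setLang.Relations 2 := SetRel.mem

/-- Formulas whose free variables are among those numbered `0, …, n - 1`. A quantifier placed in
front of a formula of `Fml (n + 1)` binds the variable numbered `n`. -/
abbrev Fml (n : ℕ) : Type := setLang.BoundedFormula Empty n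

/-- The variable with number `i`. -/
def var {n : ℕ} (i : Fin n) : setLang.Term (Empty ⊕ Fin n) := Term.var (Sum.inr i)

/-- `x ∈ y` -/
def mem {n : ℕ} (x y : Fin n) : Fml n :=
  memSymbol.boundedFormula₂ (var x) (var y)

/-- `x = y` -/
def eq {n : ℕ} (x y : Fin n) : Fml n := Term.bdEqual (var x) (var y)

/-- The variable bound by the innermost quantifier, inside that quantifier. -/
abbrev new {n : ℕ} : Fin (n + 1) := Fin.last n

/-- A variable seen from inside one more quantifier. -/
abbrev up {n : ℕ} (x : Fin n) : Fin (n + 1) := x.castSucc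

/-- A variable seen from inside two more quantifiers. -/
abbrev up2 {n : ℕ} (x : Fin n) : Fin (n + 2) := up (up x)

/-- A variable seen from inside three more quantifiers. -/
abbrev up3 {n : ℕ} (x : Fin n) : Fin (n + 3) := up (up2 x)

/-! ### The axioms of ZF -/

/-- Sets with the same elements are equal. -/
def extensionality : setLang.Sentence :=
  ∀' ∀' ((∀' (mem (n := 3) 2 0 ⇔ mem 2 1)) ⟹ eq 0 1)

/-- Every non-empty set `x` has an element that is disjoint from `x`. -/
def foundation : setLang.Sentence :=
  ∀' ((∃' mem (n := 2) 1 0) ⟹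
    ∃' (mem (n := 2) 1 0 ⊓ ∼(∃' (mem (n := 3) 2 0 ⊓ mem 2 1))))

/-- For all `x`, `y` the set `{x, y}` exists. -/
def pairing : setLang.Sentence :=
  ∀' ∀' ∃' ∀' (mem (n := 4) 3 2 ⇔ (eq 3 0 ⊔ eq 3 1))

/-- For every `x` the union of the elements of `x` exists. -/
def union : setLang.Sentence :=
  ∀' ∃' ∀' (mem (n := 3) 2 1 ⇔ ∃' (mem (n := 4) 3 0 ⊓ mem 2 3))

/-- For every `x` the set of all subsets of `x` exists. -/
def powerSet : setLang.Sentence :=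
  ∀' ∃' ∀' (mem (n := 3) 2 1 ⇔ ∀' (mem (n := 4) 3 2 ⟹ mem 3 0))

/-- Some set has an empty set as an element and contains `y ∪ {y}` for each of its elements `y`. -/
def infinity : setLang.Sentence :=
  ∃' ((∃' (mem (n := 2) 1 0 ⊓ ∀' ∼(mem (n := 3) 2 1))) ⊓
    ∀' (mem (n := 2) 1 0 ⟹
      ∃' (mem (n := 3) 2 0 ⊓ ∀' (mem (n := 4) 3 2 ⇔ (mem 3 1 ⊔ eq 3 1)))))

/-- The formula `φ` with its `n` parameters and its `k` further variables replaced by variables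
from the context `0, …, m - 1`. -/
def place {n k m : ℕ} (φ : setLang.Formula (Fin n ⊕ Fin k))
    (p : Fin n → Fin m) (x : Fin k → Fin m) : Fml m :=
  BoundedFormula.relabel (n := m) (k := 0) (fun v => Sum.inr (Sum.elim p x v)) φ

/-- The instance of separation for `φ(p, z)`: for all parameters `p` and every set `a` there is a
set `b` whose elements are the `z ∈ a` with `φ(p, z)`. Here the parameters are the variables
`0, …, n - 1`, and `a`, `b`, `z` are the variables `n`, `n + 1`, `n + 2`. -/
def separation {n : ℕ} (φ : setLang.Formula (Fin n ⊕ Fin 1)) : setLang.Sentence :=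
  BoundedFormula.alls (n := n) <|
    ∀' ∃' ∀' (mem (n := n + 3) ⟨n + 2, by omega⟩ ⟨n + 1, by omega⟩ ⇔
      (mem (n := n + 3) ⟨n + 2, by omega⟩ ⟨n, by omega⟩ ⊓
        place φ (Fin.castLE (by omega)) ![⟨n + 2, by omega⟩]))

/-- The instance of replacement for `φ(p, x, y)`: for all parameters `p` and every set `a`, if
for each `x ∈ a` there is at most one `y` with `φ(p, x, y)`, then there is a set `b` whose elements
are the `y` such that `φ(p, x, y)` for some `x ∈ a`. Here the parameters are the variables
`0, …, n - 1` and `a` is the variable `n`; in the premise, `x`, `y`, `y'` are the variables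
`n + 1`, `n + 2`, `n + 3`; in the conclusion, `b`, `y`, `x` are these variables. -/
def replacement {n : ℕ} (φ : setLang.Formula (Fin n ⊕ Fin 2)) : setLang.Sentence :=
  BoundedFormula.alls (n := n) <|
    ∀' ((∀' ∀' ∀' ((mem (n := n + 4) ⟨n + 1, by omega⟩ ⟨n, by omega⟩ ⊓
            (place φ (Fin.castLE (by omega)) ![⟨n + 1, by omega⟩, ⟨n + 2, by omega⟩] ⊓
              place φ (Fin.castLE (by omega)) ![⟨n + 1, by omega⟩, ⟨n + 3, by omega⟩])) ⟹
          eq ⟨n + 2, by omega⟩ ⟨n + 3, by omega⟩)) ⟹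
      ∃' ∀' (mem (n := n + 3) ⟨n + 2, by omega⟩ ⟨n + 1, by omega⟩ ⇔
        ∃' (mem (n := n + 4) ⟨n + 3, by omega⟩ ⟨n, by omega⟩ ⊓
          place φ (Fin.castLE (by omega)) ![⟨n + 3, by omega⟩, ⟨n + 2, by omega⟩])))

/-- Zermelo–Fraenkel set theory, without the axiom of choice. -/
def ZF : setLang.Theory :=
  {extensionality, foundation, pairing, union, powerSet, infinity} ∪
    {σ | ∃ (n : ℕ) (φ : setLang.Formula (Fin n ⊕ Fin 1)), σ = separation φ} ∪
    {σ | ∃ (n : ℕ) (φ : setLang.Formula (Fin n ⊕ Fin 2)), σ = replacement φ}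

/-! ### Functions, permutations and comparison of cardinalities, as formulas -/

/-- `p = {a, b}` -/
def isPair {n : ℕ} (p a b : Fin n) : Fml n :=
  ∀' (mem new (up p) ⇔ (eq new (up a) ⊔ eq new (up b)))

/-- `p = (a, b)`, the ordered pair `{{a}, {a, b}}` -/
def isOrderedPair {n : ℕ} (p a b : Fin n) : Fml n :=
  ∃' ∃' (isPair (up new) (up2 a) (up2 a) ⊓ isPair new (up2 a) (up2 b) ⊓
    isPair (up2 p) (up new) new)

/-- `(a, b) ∈ f` -/
def maps {n : ℕ} (f a b : Fin n) : Fml n :=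
  ∃' (isOrderedPair new (up a) (up b) ⊓ mem new (up f))

/-- `f` is a function from `x` into `y`: a subset of `x × y` that contains, for each `a ∈ x`,
exactly one pair `(a, b)`. -/
def isFunction {n : ℕ} (f x y : Fin n) : Fml n :=
  (∀' (mem new (up f) ⟹
    ∃' ∃' (mem (up new) (up3 x) ⊓ mem new (up3 y) ⊓ isOrderedPair (up2 new) (up new) new))) ⊓
  (∀' (mem new (up x) ⟹
    ∃' (maps (up2 f) (up new) new ⊓ ∀' (maps (up3 f) (up2 new) new ⟹ eq new (up new)))))

/-- `f` is an injection from `x` into `y`. -/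
def isInjection {n : ℕ} (f x y : Fin n) : Fml n :=
  isFunction f x y ⊓
    ∀' ∀' ∀' ((maps (up3 f) (up2 new) new ⊓ maps (up3 f) (up new) new) ⟹ eq (up2 new) (up new))

/-- `f` is a permutation of `x`, that is, a bijection from `x` onto `x`. -/
def isPermutation {n : ℕ} (f x : Fin n) : Fml n :=
  isInjection f x x ⊓ ∀' (mem new (up x) ⟹ ∃' maps (up2 f) new (up new))

/-- `s` is the set of all permutations of `x`. -/
def isSetOfPermutations {n : ℕ} (s x : Fin n) : Fml n :=
  ∀' (mem new (up s) ⇔ isPermutation new (up x))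

/-- `p = [x]²`, the set of all two-element subsets of `x`. -/
def isSetOfTwoElementSubsets {n : ℕ} (p x : Fin n) : Fml n :=
  ∀' (mem new (up p) ⇔
    ∃' ∃' (mem (up new) (up3 x) ⊓ mem new (up3 x) ⊓ ∼(eq (up new) new) ⊓
      isPair (up2 new) (up new) new))

/-- `|x| ≤ |y|`: there is an injection from `x` into `y`. -/
def cardLE {n : ℕ} (x y : Fin n) : Fml n :=
  ∃' isInjection new (up x) (up y)

/-- `|x| < |y|`: `|x| ≤ |y|` but not `|y| ≤ |x|`. -/
def cardLT {n : ℕ} (x y : Fin n) : Fml n :=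
  cardLE x y ⊓ ∼(cardLE y x)

/-- For every set `x`, the sets `p = [x]²` and `s` of all permutations of `x` exist and satisfy
`|p| < |s|`; that is, `[𝔞]² < 𝔞!` for the cardinal `𝔞 = |x|`. The variables `0`, `1`, `2` are
`x`, `p`, `s`. -/
def pairsLTFactorial : setLang.Sentence :=
  ∀' ∃' ∃' (isSetOfTwoElementSubsets (n := 3) 1 0 ⊓ isSetOfPermutations 2 0 ⊓ cardLT 1 2)

end SetTheoryZF

/-!
Let `x` be a set in a model of `ZF`. Sending a two-element subset `p` of `x` (an *edge*) to the
transposition of its elements embeds `[x]²` into the permutations of `x`, so the point is to show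
that no injection in the other direction exists. A *matching* is a set of pairwise disjoint edges.
Every matching `Z` yields the permutation `swap x Z` exchanging the two points of each edge in
`Z`, hence an injection of the permutations into `[x]²` would give an injection `e` of the
matchings of `x` into the edges of `x` (`MatchingInj`). This is refuted in `MatchingInj.false`, by
using `e` to build ever longer well-ordered matchings.

*The beginning.* The edge `e ∅` and the map `p ↦ e {p}` generate a Peano system of edges
(`MatchingInj.peano`), with recursion, addition, order and Cantor's pairing function. Taking the
least edges that are not covered yet, one obtains an infinite sequence of disjoint pairs
(`Peano.exists_seq`), and so a well-ordered matching `D` with an injection `D × D → D`.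

*The step.* Let `D` be a well-ordered matching with a pairing function. The points of `⋃ D` are
coded by elements of `D`, at most two points to a code, so a pair of codes `(i, j)` describes at
most four edges. Five elements of `D` are reserved for each `(i, j)`, and give five patterns "only
the `k`-th belongs to `Z`" for a submatching `Z ⊆ D`. As `e` is injective, one of the patterns is
realized by no `Z` with `e Z` described by `(i, j)`. The submatching that has for each `(i, j)`
the first such pattern is mapped by `e` to an edge not contained in `⋃ D` (`diagSet_spec`). One or
two such edges contain a new pair disjoint from `⋃ D` (`newPair_spec`), which is put at the end of
`D`.

*Carrying the pairing function.* Along a transfinite construction one would need injections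
`α × α → α` for all infinite ordinals `α`, chosen coherently. Instead, a *state* (`IsState`) has a
core `C ⊆ D` with an injection `C × C → C`, and an injection `D \ C → C`, the mate map, which
suffices to code the points of `⋃ D` by elements of `C`. New pairs get the least unused element of
`C` as their mate (`appendPair`). When the mate map is onto `C`, it serves to extend the pairing
function to all of `D`, and `D` becomes the new core (`promote`).

*The end.* States are partially ordered by extension, and chains of states have suprema
(`stateSup`). A step never leaves a state unchanged. This contradicts the Bourbaki–Witt theorem,
which holds in every model of `ZF` (`bourbaki_witt`).

All this takes place inside the model, so each use of separation needs a defining formula. The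
classes `DefPred` and `DefFun` supply these formulas by instance search. Only extensionality,
pairing, union, power set and separation are used.
-/

set_option linter.unusedSectionVars false

namespace SetTheoryZF

open FirstOrder FirstOrder.Language

/-! ### Definable predicates and functions -/

section
variable {M : Type} [setLang.Structure M]

/-- `a ∈ b` for elements of a structure is the interpretation of the membership symbol, so that
`∈`, `⊆` and all operations below are those of the model, not of the ambient theory. -/
instance : Membership M M := ⟨fun y x => Structure.RelMap memSymbol ![x, y]⟩

/-- `P` is first-order definable with parameters from `M`. The argument `v : ℕ → M` is an
environment assigning values to the variables; of these a formula uses only finitely many. Under a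
quantifier the environment is shifted: the bound variable is `v 0` and the former `v i` becomes
`v (i + 1)`. As a class it lets instance search verify the hypotheses of the separation scheme. -/
class DefPred (P : (ℕ → M) → Prop) : Prop where
  out : ∃ (n : ℕ) (p : Fin n → M) (φ : setLang.Formula (Fin n ⊕ ℕ)),
    ∀ v, P v ↔ φ.Realize (Sum.elim p v)

/-- `F` has a definable graph: the equation `v 0 = F v'` is definable, where `v'` is `v` with the
variable `v 0` dropped. -/
class DefFun (F : (ℕ → M) → M) : Prop where
  out : DefPred (fun v : ℕ → M => v 0 = F (fun i => v (i + 1)))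

theorem DefPred.congr {P Q : (ℕ → M) → Prop} (h : DefPred P) (hPQ : ∀ v, Q v ↔ P v) :
    DefPred Q := by
  rwa [funext fun v => propext (hPQ v)]

theorem DefPred.rename {P : (ℕ → M) → Prop} (h : DefPred P) (ρ : ℕ → ℕ) :
    DefPred (fun v => P (fun i => v (ρ i))) := by
  obtain ⟨n, p, φ, hφ⟩ := h
  refine ⟨n, p, φ.relabel (Sum.map id ρ), fun v => ?_⟩
  rw [hφ, Formula.realize_relabel]
  congr! 1
  ext (i | i) <;> rfl

theorem definable_mem_var (i j : ℕ) : DefPred (fun v : ℕ → M => v i ∈ v j) :=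
  ⟨0, Fin.elim0, memSymbol.formula₂ (Term.var (Sum.inr i)) (Term.var (Sum.inr j)), fun v => by
    rw [Formula.realize_rel₂]; rfl⟩

theorem definable_eq_var (i j : ℕ) : DefPred (fun v : ℕ → M => v i = v j) :=
  ⟨0, Fin.elim0, (Term.var (Sum.inr i)).equal (Term.var (Sum.inr j)), fun v => by
    rw [Formula.realize_equal]; rfl⟩

theorem definable_eq_const (i : ℕ) (c : M) : DefPred (fun v : ℕ → M => v i = c) :=
  ⟨1, fun _ => c, (Term.var (Sum.inr i)).equal (Term.var (Sum.inl 0)), fun v => by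
    rw [Formula.realize_equal]; rfl⟩

instance DefPred.not {P : (ℕ → M) → Prop} [h : DefPred P] : DefPred (fun v => ¬ P v) := by
  obtain ⟨n, p, φ, hφ⟩ := h
  exact ⟨n, p, φ.not, fun v => by rw [hφ, Formula.realize_not]⟩

instance DefPred.and {P Q : (ℕ → M) → Prop} [hP : DefPred P] [hQ : DefPred Q] :
    DefPred (fun v => P v ∧ Q v) := by
  obtain ⟨n, p, φ, hφ⟩ := hP
  obtain ⟨m, q, ψ, hψ⟩ := hQ
  refine ⟨n + m, Fin.append p q, (φ.relabel (Sum.map (Fin.castAdd m) id)) ⊓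
    (ψ.relabel (Sum.map (Fin.natAdd n) id)), fun v => ?_⟩
  rw [Formula.realize_inf, hφ, hψ, Formula.realize_relabel, Formula.realize_relabel]
  congr! 2
  · ext (i | i) <;> simp
  · ext (i | i) <;> simp

instance DefPred.ex {P : (ℕ → M) → M → Prop} [h : DefPred (fun w => P (fun i => w (i + 1)) (w 0))] :
    DefPred (fun v => ∃ y, P v y) := by
  obtain ⟨n, p, φ, hφ⟩ := h
  let g : Fin n ⊕ ℕ → (Fin n ⊕ ℕ) ⊕ Fin 1 :=
    Sum.elim (fun i => Sum.inl (Sum.inl i)) (fun i => Nat.casesOn i (Sum.inr 0) fun j =>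
      Sum.inl (Sum.inr j))
  refine ⟨n, p, (BoundedFormula.relabel (n := 1) (k := 0) g φ).ex, fun v => ?_⟩
  rw [Formula.Realize, BoundedFormula.realize_ex]
  refine exists_congr fun y => ?_
  refine (hφ (fun i => Nat.casesOn i y v)).trans ?_
  rw [BoundedFormula.realize_relabel, Formula.Realize]
  congr! 1
  ext (i | (_ | i)) <;> rfl

instance DefPred.or {P Q : (ℕ → M) → Prop} [DefPred P] [DefPred Q] : DefPred (fun v => P v ∨ Q v) :=
  DefPred.congr (P := fun v => ¬ (¬ P v ∧ ¬ Q v)) inferInstance fun v => by tauto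

instance DefPred.imp {P Q : (ℕ → M) → Prop} [DefPred P] [DefPred Q] :
    DefPred (fun v => P v → Q v) :=
  DefPred.congr (P := fun v => ¬ (P v ∧ ¬ Q v)) inferInstance fun v => by tauto

instance DefPred.iff {P Q : (ℕ → M) → Prop} [DefPred P] [DefPred Q] :
    DefPred (fun v => P v ↔ Q v) :=
  DefPred.congr (P := fun v => (P v → Q v) ∧ (Q v → P v)) inferInstance fun v => by tauto

instance DefPred.all {P : (ℕ → M) → M → Prop}
    [h : DefPred (fun w => P (fun i => w (i + 1)) (w 0))] : DefPred (fun v => ∀ y, P v y) :=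
  DefPred.congr (P := fun v => ¬ ∃ y, ¬ P v y) inferInstance fun v => by push Not; rfl

instance DefFun.var (i : ℕ) : DefFun (fun v : ℕ → M => v i) :=
  ⟨definable_eq_var 0 (i + 1)⟩

instance (priority := high) DefFun.const (c : M) : DefFun (fun _ : ℕ → M => c) :=
  ⟨definable_eq_const 0 c⟩

instance (priority := high) DefPred.const (p : Prop) : DefPred (fun _ : ℕ → M => p) := by
  by_cases h : p
  · exact ⟨0, Fin.elim0, ⊤, fun v => by simp [h]⟩
  · exact ⟨0, Fin.elim0, ⊥, fun v => by simp [h]⟩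

/-- A definable term may be substituted for a variable: `P v (F v)` says that the unique `y = F v`
satisfies `P v`. -/
theorem DefPred.subst {P : (ℕ → M) → M → Prop} (h : DefPred (fun w => P (fun i => w (i + 1)) (w 0)))
    {F : (ℕ → M) → M} [hF : DefFun F] : DefPred (fun v => P v (F v)) :=
  have := hF.out
  DefPred.congr (P := fun v => ∃ y, y = F v ∧ P v y) inferInstance fun v => by simp

theorem DefFun.rename {F : (ℕ → M) → M} [h : DefFun F] (ρ : ℕ → ℕ) :
    DefFun (fun v => F (fun i => v (ρ i))) :=
  ⟨h.out.rename (fun i => Nat.casesOn i 0 fun j => ρ j + 1)⟩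

theorem DefPred.comp₁ {R : M → Prop} (h : DefPred (fun v => R (v 0)))
    {F : (ℕ → M) → M} [DefFun F] : DefPred (fun v => R (F v)) :=
  DefPred.subst (P := fun _ y => R y) h

theorem DefPred.comp₂ {R : M → M → Prop} (h : DefPred (fun v => R (v 0) (v 1)))
    {F G : (ℕ → M) → M} [DefFun F] [DefFun G] : DefPred (fun v => R (F v) (G v)) := by
  refine DefPred.subst (P := fun v y => R (F v) y) ?_
  have : DefFun (fun w : ℕ → M => F fun i => w (i + 1)) := DefFun.rename _
  refine DefPred.subst (P := fun w y => R y (w 0)) ?_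
  exact h.rename (fun i => i)

theorem DefPred.comp₃ {R : M → M → M → Prop} (h : DefPred (fun v => R (v 0) (v 1) (v 2)))
    {F G H : (ℕ → M) → M} [DefFun F] [DefFun G] [DefFun H] :
    DefPred (fun v => R (F v) (G v) (H v)) := by
  refine DefPred.subst (P := fun v y => R (F v) (G v) y) ?_
  have : DefFun (fun w : ℕ → M => G fun i => w (i + 1)) := DefFun.rename _
  refine DefPred.subst (P := fun w y => R (F fun i => w (i + 1)) y (w 0)) ?_
  have : DefFun (fun w : ℕ → M => F fun i => w (i + 1 + 1)) := DefFun.rename _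
  refine DefPred.subst (P := fun w y => R y (w 0) (w 1)) ?_
  exact h.rename (fun i => i)

instance DefPred.mem {F G : (ℕ → M) → M} [DefFun F] [DefFun G] : DefPred (fun v => F v ∈ G v) :=
  DefPred.comp₂ (R := fun x y => x ∈ y) (definable_mem_var 0 1)

instance DefPred.eq {F G : (ℕ → M) → M} [DefFun F] [DefFun G] : DefPred (fun v => F v = G v) :=
  DefPred.comp₂ (R := fun x y => x = y) (definable_eq_var 0 1)

theorem DefFun.comp₁ {R : M → M} (h : DefPred (fun v => v 0 = R (v 1)))
    {F : (ℕ → M) → M} [DefFun F] : DefFun (fun v => R (F v)) :=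
  ⟨have : DefFun (fun w : ℕ → M => F fun i => w (i + 1)) := DefFun.rename _
   DefPred.comp₂ (R := fun x y => x = R y) h⟩

theorem DefFun.comp₂ {R : M → M → M} (h : DefPred (fun v => v 0 = R (v 1) (v 2)))
    {F G : (ℕ → M) → M} [DefFun F] [DefFun G] : DefFun (fun v => R (F v) (G v)) :=
  ⟨have : DefFun (fun w : ℕ → M => F fun i => w (i + 1)) := DefFun.rename _
   have : DefFun (fun w : ℕ → M => G fun i => w (i + 1)) := DefFun.rename _
   DefPred.comp₃ (R := fun x y z => x = R y z) h⟩

open Classical in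
/-- The unique element satisfying `P`, or an arbitrary element if there is none or more than one.
Unlike a choice function, this operator preserves definability. -/
noncomputable def the [Nonempty M] (P : M → Prop) : M :=
  if h : ∃! y, P y then h.choose else Classical.arbitrary M

theorem the_eq [Nonempty M] {P : M → Prop} {a : M} (h : P a) (hu : ∀ y, P y → y = a) :
    the P = a := by
  have h' : ∃! y, P y := ⟨a, h, hu⟩
  rw [the, dif_pos h']
  exact hu _ h'.choose_spec.1

instance DefFun.the [Nonempty M] {P : (ℕ → M) → M → Prop}
    [h : DefPred (fun w => P (fun i => w (i + 1)) (w 0))] : DefFun (fun v => the (P v)) := by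
  have h1 : DefPred (fun w : ℕ → M => P (fun i => w (i + 1 + 1)) (w 0)) :=
    h.rename (fun i => Nat.casesOn i 0 fun j => j + 2)
  have h2 : DefPred (fun w : ℕ → M => P (fun i => w (i + 1 + 1 + 1)) (w 0)) :=
    h.rename (fun i => Nat.casesOn i 0 fun j => j + 3)
  have h3 : DefPred (fun w : ℕ → M => P (fun i => w (i + 1 + 1 + 1)) (w 1)) :=
    h.rename (fun i => Nat.casesOn i 1 fun j => j + 3)
  refine ⟨DefPred.congr (P := fun v => (P (fun i => v (i + 1)) (v 0) ∧
    ∀ y, P (fun i => v (i + 1)) y → y = v 0) ∨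
    (¬ (∃ y, P (fun i => v (i + 1)) y ∧ ∀ z, P (fun i => v (i + 1)) z → z = y)) ∧
      v 0 = Classical.arbitrary M) inferInstance fun v => ?_⟩
  by_cases h' : ∃! y, P (fun i => v (i + 1)) y
  · obtain ⟨y, hy, hu⟩ := h'
    rw [the_eq hy hu]
    constructor
    · rintro hv
      left
      rw [hv]
      exact ⟨hy, hu⟩
    · rintro (h | h)
      · exact hu _ h.1
      · exact absurd ⟨y, hy, hu⟩ h.1
  · rw [SetTheoryZF.the, dif_neg h']
    constructor
    · exact fun hv => Or.inr ⟨h', hv⟩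
    · rintro (h | h)
      · exact absurd ⟨_, h⟩ h'
      · exact h.2

/-- Quantification over a standard finite type is a finite disjunction, hence definable. -/
instance DefPred.exFin : {n : ℕ} → {P : (ℕ → M) → Fin n → Prop} →
    [∀ k, DefPred (fun v => P v k)] → DefPred (fun v => ∃ k, P v k)
  | 0, P, _ => DefPred.congr (P := fun _ => False) inferInstance fun v => by simp
  | n + 1, P, _ =>
    have := DefPred.exFin (P := fun v (k : Fin n) => P v k.succ)
    DefPred.congr (P := fun v => P v 0 ∨ ∃ k : Fin n, P v k.succ) inferInstance fun v => by
      rw [Fin.exists_fin_succ]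

instance DefPred.allFin {n : ℕ} {P : (ℕ → M) → Fin n → Prop} [∀ k, DefPred (fun v => P v k)] :
    DefPred (fun v => ∀ k, P v k) :=
  DefPred.congr (P := fun v => ¬ ∃ k, ¬ P v k) inferInstance fun v => by push Not; rfl

end

section
variable {M : Type} [setLang.Structure M]

/-! ### The axioms in a model -/

theorem realize_mem (v : Empty → M) {n : ℕ} (i j : Fin n) (xs : Fin n → M) :
    (mem i j).Realize v xs ↔ xs i ∈ xs j := by
  rw [mem, BoundedFormula.realize_rel₂]; rfl

theorem realize_eq (v : Empty → M) {n : ℕ} (i j : Fin n) (xs : Fin n → M) :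
    (eq i j).Realize v xs ↔ xs i = xs j := by
  rw [eq, BoundedFormula.realize_bdEqual]; rfl

theorem realize_place (v : Empty → M) {n k m : ℕ} (φ : setLang.Formula (Fin n ⊕ Fin k))
    (p : Fin n → Fin m) (x : Fin k → Fin m) (xs : Fin m → M) :
    (place φ p x).Realize v xs ↔ φ.Realize (Sum.elim (xs ∘ p) (xs ∘ x)) := by
  unfold place
  have h := BoundedFormula.realize_relabel (m := m) (n := 0) (φ := φ) (v := v) (xs := xs)
    (g := fun i => (Sum.inr (Sum.elim p x i) : Empty ⊕ Fin m))
  refine h.trans ?_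
  rw [Formula.Realize]
  have : (xs ∘ Fin.natAdd m : Fin 0 → M) = default := Subsingleton.elim _ _
  rw [this]
  congr! 1
  ext (i | i) <;> rfl

variable [hM : M ⊨ ZF]

theorem ext_mem {a b : M} (h : ∀ z, z ∈ a ↔ z ∈ b) : a = b := by
  have := hM.realize_of_mem extensionality (by simp [ZF])
  simp [extensionality, Sentence.Realize, Formula.Realize, realize_mem, realize_eq,
    Fin.snoc] at this
  exact this a b h

theorem exists_pairing (a b : M) : ∃ c : M, ∀ z, z ∈ c ↔ z = a ∨ z = b := by
  have := hM.realize_of_mem pairing (by simp [ZF])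
  simp [pairing, Sentence.Realize, Formula.Realize, realize_mem, realize_eq, Fin.snoc] at this
  exact this a b

theorem exists_bigUnion (a : M) : ∃ c : M, ∀ z, z ∈ c ↔ ∃ y, y ∈ a ∧ z ∈ y := by
  have := hM.realize_of_mem union (by simp [ZF])
  simp [union, Sentence.Realize, Formula.Realize, realize_mem, Fin.snoc] at this
  exact this a

theorem exists_powerSet (a : M) : ∃ c : M, ∀ z, z ∈ c ↔ ∀ y, y ∈ z → y ∈ a := by
  have := hM.realize_of_mem powerSet (by simp [ZF])
  simp [powerSet, Sentence.Realize, Formula.Realize, realize_mem, Fin.snoc] at this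
  exact this a

/-- Separation for any definable predicate; parameters from the model are allowed. -/
theorem exists_sep (a : M) (P : M → Prop) [h : DefPred (fun v => P (v 0))] :
    ∃ c : M, ∀ z, z ∈ c ↔ z ∈ a ∧ P z := by
  obtain ⟨n, p, φ, hφ⟩ := h
  have := hM.realize_of_mem (separation (φ.relabel (Sum.map id (fun _ => 0))))
    (by left; right; exact ⟨n, _, rfl⟩)
  rw [separation, Sentence.Realize, BoundedFormula.realize_alls] at this
  have := this p
  simp only [BoundedFormula.realize_all, BoundedFormula.realize_ex, BoundedFormula.realize_iff,
    BoundedFormula.realize_inf, realize_mem, realize_place] at this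
  obtain ⟨c, hc⟩ := this a
  refine ⟨c, fun z => ?_⟩
  have hz : (Formula.relabel (Sum.map id fun _ => (0 : Fin 1)) φ).Realize
      (Sum.elim p (fun _ => z)) ↔ P z := by
    rw [hφ (fun _ => z), Formula.realize_relabel]
    congr! 1
    ext (i | i) <;> rfl
  rw [← hz]
  convert hc z using 2
  · simp [Fin.snoc]
  · simp [Fin.snoc]
  · simp [Fin.snoc]
  · congr! 1
    ext (i | i)
    · simp [Fin.snoc, show (i : ℕ) ≤ n + 1 by omega]
      rfl
    · simp [Fin.snoc]

/-! ### Elementary set operations in a model -/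

variable [Nonempty M]

/-- The set of elements of `a` satisfying `P`; meaningful if `P` is definable. -/
noncomputable def sep (a : M) (P : M → Prop) : M := the fun b => ∀ z, z ∈ b ↔ z ∈ a ∧ P z

/-- The unordered pair. -/
noncomputable def upair (a b : M) : M := the fun c => ∀ z, z ∈ c ↔ z = a ∨ z = b

/-- The union of the elements of `a`. -/
noncomputable def bigUnion (a : M) : M := the fun c => ∀ z, z ∈ c ↔ ∃ y, y ∈ a ∧ z ∈ y

/-- The power set. -/
noncomputable def pow (a : M) : M := the fun c => ∀ z, z ∈ c ↔ ∀ y, y ∈ z → y ∈ a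

instance : HasSubset M := ⟨fun a b => ∀ z ∈ a, z ∈ b⟩

theorem subset_def {a b : M} : a ⊆ b ↔ ∀ z ∈ a, z ∈ b := Iff.rfl

/-- By extensionality, a set described by its elements is picked out by `the` as soon as it
exists. -/
theorem mem_the {P : M → Prop} {Q : M → Prop} (h : ∃ c : M, ∀ z, z ∈ c ↔ Q z)
    (hP : ∀ c, P c ↔ ∀ z, z ∈ c ↔ Q z) (z : M) : z ∈ the P ↔ Q z := by
  obtain ⟨c, hc⟩ := h
  rw [the_eq ((hP c).2 hc) fun y hy => ext_mem fun z => ((hP y).1 hy z).trans (hc z).symm]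
  exact hc z

@[simp] theorem mem_sep {a z : M} {P : M → Prop} [DefPred (fun v => P (v 0))] :
    z ∈ sep a P ↔ z ∈ a ∧ P z := mem_the (exists_sep a P) (fun _ => Iff.rfl) z

@[simp] theorem mem_upair {a b z : M} : z ∈ upair a b ↔ z = a ∨ z = b :=
  mem_the (exists_pairing a b) (fun _ => Iff.rfl) z

@[simp] theorem mem_bigUnion {a z : M} : z ∈ bigUnion a ↔ ∃ y ∈ a, z ∈ y :=
  mem_the (exists_bigUnion a) (fun _ => Iff.rfl) z

@[simp] theorem mem_pow {a z : M} : z ∈ pow a ↔ z ⊆ a :=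
  mem_the (exists_powerSet a) (fun _ => Iff.rfl) z

instance {A : (ℕ → M) → M} {P : (ℕ → M) → M → Prop} [DefFun A]
    [h : DefPred (fun w => P (fun i => w (i + 1)) (w 0))] : DefFun (fun v => sep (A v) (P v)) := by
  have h1 : DefPred (fun w : ℕ → M => P (fun i => w (i + 1 + 1)) (w 0)) :=
    h.rename (fun i => Nat.casesOn i 0 fun j => j + 2)
  have h2 : DefFun (fun w : ℕ → M => A fun i => w (i + 1 + 1)) := DefFun.rename _
  unfold sep
  infer_instance

instance {F G : (ℕ → M) → M} [DefFun F] [DefFun G] : DefPred (fun v => F v ⊆ G v) :=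
  DefPred.comp₂ (R := fun a b : M => a ⊆ b) (by simp only [subset_def]; infer_instance)

instance {F G : (ℕ → M) → M} [DefFun F] [DefFun G] : DefFun (fun v => upair (F v) (G v)) :=
  DefFun.comp₂ (by unfold upair; infer_instance)

instance {F : (ℕ → M) → M} [DefFun F] : DefFun (fun v => bigUnion (F v)) :=
  DefFun.comp₁ (by unfold bigUnion; infer_instance)

instance {F : (ℕ → M) → M} [DefFun F] : DefFun (fun v => pow (F v)) :=
  DefFun.comp₁ (by unfold pow; infer_instance)

/-- The empty set. -/
noncomputable def empty : M := sep (Classical.arbitrary M) fun _ => False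

@[simp] theorem not_mem_empty (z : M) : ¬ z ∈ (empty : M) := by simp [empty]

/-- The singleton. -/
noncomputable def single (a : M) : M := upair a a

/-- The union of two sets. -/
noncomputable def cup (a b : M) : M := bigUnion (upair a b)

/-- The set difference. -/
noncomputable def diff (a b : M) : M := sep a fun z => ¬ z ∈ b

/-- The Kuratowski ordered pair. -/
noncomputable def opair (a b : M) : M := upair (upair a a) (upair a b)

instance {F : (ℕ → M) → M} [DefFun F] : DefFun (fun v => single (F v)) := by
  unfold single; infer_instance

instance {F G : (ℕ → M) → M} [DefFun F] [DefFun G] : DefFun (fun v => cup (F v) (G v)) := by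
  unfold cup; infer_instance

instance {F G : (ℕ → M) → M} [DefFun F] [DefFun G] : DefFun (fun v => diff (F v) (G v)) :=
  DefFun.comp₂ (by unfold diff; infer_instance)

instance {F G : (ℕ → M) → M} [DefFun F] [DefFun G] : DefFun (fun v => opair (F v) (G v)) := by
  unfold opair; infer_instance

@[simp] theorem mem_single {a z : M} : z ∈ single a ↔ z = a := by simp [single]

@[simp] theorem mem_cup {a b z : M} : z ∈ cup a b ↔ z ∈ a ∨ z ∈ b := by simp [cup]

@[simp] theorem mem_diff {a b z : M} : z ∈ diff a b ↔ z ∈ a ∧ ¬ z ∈ b := by simp [diff]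

theorem upair_inj {a b c d : M} (h : upair a b = upair c d) :
    a = c ∧ b = d ∨ a = d ∧ b = c := by
  have h1 : a ∈ upair c d := h ▸ by simp
  have h2 : b ∈ upair c d := h ▸ by simp
  have h3 : c ∈ upair a b := h ▸ by simp
  have h4 : d ∈ upair a b := h ▸ by simp
  simp only [mem_upair] at h1 h2 h3 h4
  grind

theorem upair_comm (a b : M) : upair a b = upair b a := ext_mem fun z => by simp [or_comm]

@[simp] theorem opair_inj {a b c d : M} : opair a b = opair c d ↔ a = c ∧ b = d := by
  refine ⟨fun h => ?_, by rintro ⟨rfl, rfl⟩; rfl⟩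
  rcases upair_inj h with ⟨h1, h2⟩ | ⟨h1, h2⟩ <;> rcases upair_inj h1 with h | h <;>
    rcases upair_inj h2 with h' | h' <;> grind

/-- The first coordinate of an ordered pair; an arbitrary set if `p` is not a pair. -/
noncomputable def fst (p : M) : M := the fun a => ∃ b, p = opair a b

/-- The second coordinate of an ordered pair; an arbitrary set if `p` is not a pair. -/
noncomputable def snd (p : M) : M := the fun b => ∃ a, p = opair a b

@[simp] theorem fst_opair (a b : M) : fst (opair a b) = a :=
  the_eq ⟨b, rfl⟩ (by rintro y ⟨c, hc⟩; exact (opair_inj.1 hc).1.symm)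

@[simp] theorem snd_opair (a b : M) : snd (opair a b) = b :=
  the_eq ⟨a, rfl⟩ (by rintro y ⟨c, hc⟩; exact (opair_inj.1 hc).2.symm)

instance {F : (ℕ → M) → M} [DefFun F] : DefFun (fun v => fst (F v)) :=
  DefFun.comp₁ (by unfold fst; infer_instance)

instance {F : (ℕ → M) → M} [DefFun F] : DefFun (fun v => snd (F v)) :=
  DefFun.comp₁ (by unfold snd; infer_instance)

/-- The Cartesian product. -/
noncomputable def prod (a b : M) : M :=
  sep (pow (pow (cup a b))) fun p => ∃ y ∈ a, ∃ z ∈ b, p = opair y z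

instance {F G : (ℕ → M) → M} [DefFun F] [DefFun G] : DefFun (fun v => prod (F v) (G v)) :=
  DefFun.comp₂ (by unfold prod; infer_instance)

theorem mem_prod {a b p : M} : p ∈ prod a b ↔ ∃ y ∈ a, ∃ z ∈ b, p = opair y z := by
  rw [prod, mem_sep, and_iff_right_iff_imp]
  rintro ⟨y, hy, z, hz, rfl⟩
  simp only [mem_pow, subset_def, opair, mem_upair, mem_cup]
  rintro w (rfl | rfl) u hu <;> simp at hu <;> grind

@[simp] theorem opair_mem_prod {a b y z : M} : opair y z ∈ prod a b ↔ y ∈ a ∧ z ∈ b := by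
  rw [mem_prod]
  constructor
  · rintro ⟨_, h1, _, h2, h⟩
    obtain ⟨rfl, rfl⟩ := opair_inj.1 h
    exact ⟨h1, h2⟩
  · exact fun h => ⟨y, h.1, z, h.2, rfl⟩

/-- The value at `a` of the function with graph `f`; an arbitrary set if `a` has no value or
several. -/
noncomputable def app (f a : M) : M := the fun b => opair a b ∈ f

instance {F G : (ℕ → M) → M} [DefFun F] [DefFun G] : DefFun (fun v => app (F v) (G v)) :=
  DefFun.comp₂ (by unfold app; infer_instance)

/-- `f` is the graph of an injection of `X` into `Y`. -/
structure IsInjFun (f X Y : M) : Prop where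
  sub : f ⊆ prod X Y
  total : ∀ a ∈ X, ∃ b, opair a b ∈ f
  func : ∀ a b c, opair a b ∈ f → opair a c ∈ f → b = c
  inj : ∀ a b c, opair a c ∈ f → opair b c ∈ f → a = b

theorem isInjFun_iff {f X Y : M} : IsInjFun f X Y ↔ f ⊆ prod X Y ∧ (∀ a ∈ X, ∃ b, opair a b ∈ f) ∧
    (∀ a b c, opair a b ∈ f → opair a c ∈ f → b = c) ∧
      ∀ a b c, opair a c ∈ f → opair b c ∈ f → a = b :=
  ⟨fun h => ⟨h.1, h.2, h.3, h.4⟩, fun h => ⟨h.1, h.2.1, h.2.2.1, h.2.2.2⟩⟩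

instance {F G H : (ℕ → M) → M} [DefFun F] [DefFun G] [DefFun H] :
    DefPred (fun v => IsInjFun (F v) (G v) (H v)) :=
  DefPred.comp₃ (R := fun x y z : M => IsInjFun x y z) (by simp only [isInjFun_iff]; infer_instance)

namespace IsInjFun
variable {f X Y : M} (h : IsInjFun f X Y)
include h

theorem app_eq {a b : M} (hab : opair a b ∈ f) : app f a = b :=
  the_eq hab fun _ hy => h.func _ _ _ hy hab

theorem opair_app {a : M} (ha : a ∈ X) : opair a (app f a) ∈ f := by
  obtain ⟨b, hb⟩ := h.total a ha
  rwa [h.app_eq hb]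

theorem app_mem {a : M} (ha : a ∈ X) : app f a ∈ Y :=
  (opair_mem_prod.1 (h.sub _ (h.opair_app ha))).2

theorem app_inj {a b : M} (ha : a ∈ X) (hb : b ∈ X) (hab : app f a = app f b) : a = b :=
  h.inj _ _ _ (h.opair_app ha) (hab ▸ h.opair_app hb)

end IsInjFun
end

section
variable {M : Type} [setLang.Structure M] [hM : M ⊨ ZF] [Nonempty M]

/-! ### The Bourbaki–Witt theorem inside a model -/

/-- `C` is a nonempty chain of `P`, for the (external, but definable) relation `le`. -/
def IsChainIn (P : M) (le : M → M → Prop) (C : M) : Prop :=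
  C ⊆ P ∧ (∃ c, c ∈ C) ∧ ∀ c ∈ C, ∀ d ∈ C, le c d ∨ le d c

/-- Inside a model of `ZF`, a definable inflationary map of a partially ordered set in which every
nonempty chain has a definable supremum has a fixed point. Neither choice nor ordinals are used:
the least set `T` that contains `a` and is closed under the map and under suprema of chains is
itself a chain, and its supremum is the fixed point. -/
theorem bourbaki_witt {P a : M} {le : M → M → Prop} {F Sup : M → M}
    (dle : DefPred (fun v : ℕ → M => le (v 0) (v 1)))
    (dF : DefPred (fun v : ℕ → M => v 0 = F (v 1)))
    (dSup : DefPred (fun v : ℕ → M => v 0 = Sup (v 1)))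
    (ha : a ∈ P) (refl : ∀ s ∈ P, le s s)
    (trans : ∀ s ∈ P, ∀ t ∈ P, ∀ u ∈ P, le s t → le t u → le s u)
    (antisymm : ∀ s ∈ P, ∀ t ∈ P, le s t → le t s → s = t)
    (hF : ∀ s ∈ P, F s ∈ P) (infl : ∀ s ∈ P, le s (F s))
    (hSup : ∀ C, IsChainIn P le C → Sup C ∈ P ∧ (∀ c ∈ C, le c (Sup C)) ∧
      ∀ u ∈ P, (∀ c ∈ C, le c u) → le (Sup C) u) :
    ∃ s ∈ P, F s = s := by
  have ile : ∀ {A B : (ℕ → M) → M} [DefFun A] [DefFun B], DefPred (fun v => le (A v) (B v)) :=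
    DefPred.comp₂ dle
  have iF : ∀ {A : (ℕ → M) → M} [DefFun A], DefFun (fun v => F (A v)) := DefFun.comp₁ dF
  have iSup : ∀ {A : (ℕ → M) → M} [DefFun A], DefFun (fun v => Sup (A v)) := DefFun.comp₁ dSup
  have iCh : ∀ {A : (ℕ → M) → M} [DefFun A], DefPred (fun v => IsChainIn P le (A v)) :=
    DefPred.comp₁ (R := fun C => IsChainIn P le C) (by unfold IsChainIn; infer_instance)
  let Cl : M → Prop := fun X => a ∈ X ∧ (∀ s ∈ X, F s ∈ X) ∧
    ∀ C, IsChainIn P le C → C ⊆ X → Sup C ∈ X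
  let T : M := sep P fun s => ∀ X, Cl X → s ∈ X
  have hT : ∀ s, s ∈ T ↔ s ∈ P ∧ ∀ X, Cl X → s ∈ X := fun s => mem_sep
  have aT : a ∈ T := (hT a).2 ⟨ha, fun X hX => hX.1⟩
  have FT : ∀ s ∈ T, F s ∈ T := fun s hs =>
    (hT _).2 ⟨hF _ ((hT s).1 hs).1, fun X hX => hX.2.1 _ (((hT s).1 hs).2 X hX)⟩
  have ST : ∀ C, IsChainIn P le C → C ⊆ T → Sup C ∈ T := fun C hC hCT =>
    (hT _).2 ⟨(hSup C hC).1, fun X hX => hX.2.2 C hC fun c hc => ((hT c).1 (hCT c hc)).2 X hX⟩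
  have TP : ∀ s ∈ T, s ∈ P := fun s hs => ((hT s).1 hs).1
  have ind : ∀ Q : M → Prop, DefPred (fun v => Q (v 0)) → Q a → (∀ s ∈ T, Q s → Q (F s)) →
      (∀ C, IsChainIn P le C → C ⊆ T → (∀ c ∈ C, Q c) → Q (Sup C)) → ∀ s ∈ T, Q s := by
    intro Q hQ h0 h1 h2 s hs
    have : s ∈ sep T Q := ((hT s).1 hs).2 _ ⟨mem_sep.2 ⟨aT, h0⟩,
      fun t ht => mem_sep.2 ⟨FT _ (mem_sep.1 ht).1, h1 _ (mem_sep.1 ht).1 (mem_sep.1 ht).2⟩,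
      fun C hC hCX => mem_sep.2 ⟨ST C hC fun c hc => (mem_sep.1 (hCX c hc)).1,
        h2 C hC (fun c hc => (mem_sep.1 (hCX c hc)).1) fun c hc => (mem_sep.1 (hCX c hc)).2⟩⟩
    exact (mem_sep.1 this).2
  have least : ∀ s ∈ T, le a s := by
    refine ind (fun s => le a s) inferInstance (refl a ha) (fun s hs h => ?_) fun C hC hCT h => ?_
    · exact trans a ha s (TP s hs) _ (hF _ (TP s hs)) h (infl s (TP s hs))
    · obtain ⟨c, hc⟩ := hC.2.1
      exact trans a ha c (hC.1 c hc) _ (hSup C hC).1 (h c hc) ((hSup C hC).2.1 c hc)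
  -- the extreme elements: every element of `T` strictly below `c` stays below `c`
  -- after one step
  let Ext : M → Prop := fun c => ∀ s ∈ T, le s c → s = c ∨ le (F s) c
  have iExt : DefPred (fun v : ℕ → M => Ext (v 0)) := by simp only [Ext]; infer_instance
  have comp : ∀ c ∈ T, Ext c → ∀ s ∈ T, le s c ∨ le (F c) s := by
    intro c hc hE
    refine ind (fun s => le s c ∨ le (F c) s) inferInstance (Or.inl (least c hc))
      (fun s hs h => ?_) fun C hC hCT h => ?_
    · rcases h with h | h
      · rcases hE s hs h with rfl | h'
        · exact Or.inr (refl _ (hF _ (TP _ hs)))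
        · exact Or.inl h'
      · exact Or.inr (trans _ (hF _ (TP c hc)) s (TP s hs) _ (hF _ (TP s hs)) h
          (infl s (TP s hs)))
    · by_cases h' : ∃ s ∈ C, le (F c) s
      · obtain ⟨s, hs, h'⟩ := h'
        exact Or.inr (trans _ (hF _ (TP c hc)) s (hC.1 s hs) _ (hSup C hC).1 h'
          ((hSup C hC).2.1 s hs))
      · refine Or.inl ((hSup C hC).2.2 c (TP c hc) fun s hs => (h s hs).resolve_right fun h'' => ?_)
        exact h' ⟨s, hs, h''⟩
  have allExt : ∀ c ∈ T, Ext c := by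
    refine ind Ext iExt ?_ (fun c hc hE s hs hsc => ?_) fun C hC hCT h s hs hsC => ?_
    · exact fun s hs h => Or.inl (antisymm s (TP s hs) a ha h (least s hs))
    · rcases comp c hc hE s hs with h | h
      · rcases hE s hs h with rfl | h'
        · exact Or.inr (refl _ (hF _ (TP _ hs)))
        · exact Or.inr (trans _ (hF _ (TP s hs)) c (TP c hc) _ (hF _ (TP c hc)) h'
            (infl c (TP c hc)))
      · exact Or.inl (antisymm _ (TP _ hs) _ (hF _ (TP c hc)) hsc h)
    · by_cases h' : ∀ c ∈ C, le c s
      · exact Or.inl (antisymm _ (TP s hs) _ (hSup C hC).1 hsC ((hSup C hC).2.2 s (TP s hs) h'))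
      · push Not at h'
        obtain ⟨c, hc, hcs⟩ := h'
        have hcT := hCT c hc
        have hsc : le s c := (comp c hcT (h c hc) s hs).resolve_right fun h' =>
          hcs (trans _ (TP c hcT) _ (hF _ (TP c hcT)) _ (TP s hs) (infl c (TP c hcT)) h')
        rcases h c hc s hs hsc with rfl | h'
        · exact absurd (refl _ (TP _ hs)) hcs
        · exact Or.inr (trans _ (hF _ (TP s hs)) c (TP c hcT) _ (hSup C hC).1 h'
            ((hSup C hC).2.1 c hc))
  have hTc : IsChainIn P le T := by
    refine ⟨TP, ⟨a, aT⟩, fun c hc d hd => ?_⟩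
    rcases comp d hd (allExt d hd) c hc with h | h
    · exact Or.inl h
    · exact Or.inr (trans _ (TP d hd) _ (hF _ (TP d hd)) _ (TP c hc) (infl d (TP d hd)) h)
  have hb := ST T hTc fun _ h => h
  exact ⟨Sup T, TP _ hb, antisymm _ (hF _ (TP _ hb)) _ (TP _ hb)
    ((hSup T hTc).2.1 _ (FT _ hb)) (infl _ (TP _ hb))⟩

/-! ### Peano systems and recursion -/

/-- `N` with zero `z` and successor `S` is a Peano system of the model: induction holds for all
subsets of the model. Such a system replaces `ω`, which makes the axiom of infinity unnecessary.
-/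
structure Peano (N z : M) (S : M → M) : Prop where
  definable : DefPred (fun v : ℕ → M => v 0 = S (v 1))
  zero_mem : z ∈ N
  succ_mem : ∀ n ∈ N, S n ∈ N
  succ_inj : ∀ m ∈ N, ∀ n ∈ N, S m = S n → m = n
  succ_ne : ∀ n ∈ N, S n ≠ z
  sub_of_closed : ∀ X, z ∈ X → (∀ n ∈ N, n ∈ X → S n ∈ X) → N ⊆ X

theorem Peano.ind {N z : M} {S : M → M} (h : Peano N z S) (Q : M → Prop)
    [DefPred (fun v => Q (v 0))] (h0 : Q z) (h1 : ∀ n ∈ N, Q n → Q (S n)) : ∀ n ∈ N, Q n := by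
  intro n hn
  exact (mem_sep.1 (h.sub_of_closed (sep N Q) (mem_sep.2 ⟨h.zero_mem, h0⟩) (fun n hn h' =>
    mem_sep.2 ⟨h.succ_mem n hn, h1 n hn (mem_sep.1 h').2⟩) n hn)).2

/-- The graph of the function `N → Y` with `z ↦ y` and `S n ↦ G u` whenever `n ↦ u`: the least
relation closed under these two rules. -/
noncomputable def recGraph (N z : M) (S : M → M) (Y : M) (G : M → M) (y : M) : M :=
  sep (prod N Y) fun p => ∀ ρ : M, opair z y ∈ ρ →
    (∀ n ∈ N, ∀ u ∈ Y, opair n u ∈ ρ → opair (S n) (G u) ∈ ρ) → p ∈ ρ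

theorem Peano.definable_rec {N z : M} {S : M → M} (h : Peano N z S) {Y : M} {G : M → M}
    (dG : DefPred (fun v : ℕ → M => v 0 = G (v 1))) :
    DefPred (fun v : ℕ → M => v 0 = app (recGraph N z S Y G (v 1)) (v 2)) := by
  have iS : ∀ {A : (ℕ → M) → M} [DefFun A], DefFun (fun v => S (A v)) := DefFun.comp₁ h.definable
  have iG : ∀ {A : (ℕ → M) → M} [DefFun A], DefFun (fun v => G (A v)) := DefFun.comp₁ dG
  unfold recGraph
  infer_instance

/-- Recursion: the least relation closed under the two rules is a function and satisfies the
equations. -/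
theorem Peano.rec_spec {N z : M} {S : M → M} (h : Peano N z S) {Y y : M} {G : M → M}
    (dG : DefPred (fun v : ℕ → M => v 0 = G (v 1))) (hy : y ∈ Y) (hG : ∀ u ∈ Y, G u ∈ Y) :
    app (recGraph N z S Y G y) z = y ∧
    (∀ n ∈ N, app (recGraph N z S Y G y) (S n) = G (app (recGraph N z S Y G y) n)) ∧
    ∀ n ∈ N, app (recGraph N z S Y G y) n ∈ Y := by
  have iS : ∀ {A : (ℕ → M) → M} [DefFun A], DefFun (fun v => S (A v)) := DefFun.comp₁ h.definable
  have iG : ∀ {A : (ℕ → M) → M} [DefFun A], DefFun (fun v => G (A v)) := DefFun.comp₁ dG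
  set r := recGraph N z S Y G y with hr
  have hr : ∀ p, p ∈ r ↔ p ∈ prod N Y ∧ ∀ ρ, opair z y ∈ ρ →
    (∀ n ∈ N, ∀ u ∈ Y, opair n u ∈ ρ → opair (S n) (G u) ∈ ρ) → p ∈ ρ := fun p => mem_sep
  have h0 : opair z y ∈ r := (hr _).2 ⟨opair_mem_prod.2 ⟨h.zero_mem, hy⟩, fun ρ h _ => h⟩
  have h1 : ∀ n u, opair n u ∈ r → opair (S n) (G u) ∈ r := fun n u hnu => by
    obtain ⟨h2, h3⟩ := (hr _).1 hnu
    have h2 := opair_mem_prod.1 h2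
    exact (hr _).2 ⟨opair_mem_prod.2 ⟨h.succ_mem _ h2.1, hG _ h2.2⟩,
      fun ρ hρ hρ' => hρ' n h2.1 u h2.2 (h3 ρ hρ hρ')⟩
  have hrY : ∀ n u, opair n u ∈ r → n ∈ N ∧ u ∈ Y := fun n u h => opair_mem_prod.1 ((hr _).1 h).1
  -- a pair that is neither the initial one nor forced by another one can be removed
  have hrm : ∀ q ∈ r, q ≠ opair z y → ∃ n u, opair n u ∈ r ∧ q = opair (S n) (G u) := by
    intro q hq hqz
    by_contra hcon
    push Not at hcon
    have := ((hr q).1 hq).2 (sep r fun p => p ≠ q) (mem_sep.2 ⟨h0, hqz.symm⟩) fun n _ u _ hnu =>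
      mem_sep.2 ⟨h1 _ _ (mem_sep.1 hnu).1, (hcon n u (mem_sep.1 hnu).1).symm⟩
    exact (mem_sep.1 this).2 rfl
  have key : ∀ n ∈ N, ∃ u, opair n u ∈ r ∧ ∀ w, opair n w ∈ r → w = u := by
    refine h.ind _ ⟨y, h0, fun w hw => ?_⟩ fun n hn hu => ?_
    · by_contra hne
      obtain ⟨n, u, hnu, he⟩ := hrm _ hw (by simpa using hne)
      exact h.succ_ne n (hrY _ _ hnu).1 (opair_inj.1 he).1.symm
    · obtain ⟨u, hu, huu⟩ := hu
      refine ⟨G u, h1 _ _ hu, fun w hw => ?_⟩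
      obtain ⟨m, t, hmt, he⟩ := hrm _ hw fun he => h.succ_ne n hn (opair_inj.1 he).1
      obtain ⟨he1, he2⟩ := opair_inj.1 he
      obtain rfl := h.succ_inj _ hn _ (hrY _ _ hmt).1 he1
      rw [he2, huu t hmt]
  have app_eq : ∀ n u, opair n u ∈ r → app r n = u := fun n u hnu => by
    obtain ⟨w, hw, hww⟩ := key n (hrY _ _ hnu).1
    exact the_eq hnu fun t ht => by rw [hww t ht, hww u hnu]
  have opair_app : ∀ n ∈ N, opair n (app r n) ∈ r := fun n hn => by
    obtain ⟨w, hw, hww⟩ := key n hn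
    rwa [app_eq n w hw]
  exact ⟨app_eq _ _ h0, fun n hn => app_eq _ _ (h1 _ _ (opair_app n hn)),
    fun n hn => (hrY _ _ (opair_app n hn)).2⟩

end

section
variable {M : Type} [setLang.Structure M] [hM : M ⊨ ZF] [Nonempty M]

/-! ### Arithmetic of a Peano system -/

/-- Addition, by recursion on `n`. -/
noncomputable def pAdd (N z : M) (S : M → M) (m n : M) : M := app (recGraph N z S N S m) n

/-- The order `m ≤ n`, defined by addition. -/
def pLe (N z : M) (S : M → M) (m n : M) : Prop := ∃ k ∈ N, n = pAdd N z S m k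

/-- The step `(m, k + 1) ↦ (m + 1, k)`, `(m, 0) ↦ (0, m + 1)` of Cantor's enumeration of pairs
along the diagonals. -/
noncomputable def cantorNext (N z : M) (S : M → M) (p : M) : M :=
  the fun q => (snd p = z ∧ q = opair z (S (fst p))) ∨
    ∃ k ∈ N, snd p = S k ∧ q = opair (S (fst p)) k

namespace Peano
variable {N z : M} {S : M → M} (h : Peano N z S)
include h

theorem definable_add : DefPred (fun v : ℕ → M => v 0 = pAdd N z S (v 1) (v 2)) :=
  h.definable_rec h.definable

theorem definable_le : DefPred (fun v : ℕ → M => pLe N z S (v 0) (v 1)) := by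
  have iA : ∀ {A B : (ℕ → M) → M} [DefFun A] [DefFun B], DefFun (fun v => pAdd N z S (A v) (B v)) :=
    DefFun.comp₂ h.definable_add
  unfold pLe
  infer_instance

theorem add_zero {m : M} (hm : m ∈ N) : pAdd N z S m z = m :=
  (h.rec_spec h.definable hm h.succ_mem).1

theorem add_succ {m n : M} (hm : m ∈ N) (hn : n ∈ N) :
    pAdd N z S m (S n) = S (pAdd N z S m n) :=
  (h.rec_spec h.definable hm h.succ_mem).2.1 n hn

theorem add_mem {m n : M} (hm : m ∈ N) (hn : n ∈ N) : pAdd N z S m n ∈ N :=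
  (h.rec_spec h.definable hm h.succ_mem).2.2 n hn

theorem zero_add {n : M} (hn : n ∈ N) : pAdd N z S z n = n := by
  have iA : ∀ {A B : (ℕ → M) → M} [DefFun A] [DefFun B], DefFun (fun v => pAdd N z S (A v) (B v)) :=
    DefFun.comp₂ h.definable_add
  refine h.ind (fun n => pAdd N z S z n = n) (h.add_zero h.zero_mem) (fun n hn h' => ?_) n hn
  rw [h.add_succ h.zero_mem hn, h']

theorem succ_add {m n : M} (hm : m ∈ N) (hn : n ∈ N) :
    pAdd N z S (S m) n = S (pAdd N z S m n) := by
  have iS : ∀ {A : (ℕ → M) → M} [DefFun A], DefFun (fun v => S (A v)) := DefFun.comp₁ h.definable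
  have iA : ∀ {A B : (ℕ → M) → M} [DefFun A] [DefFun B], DefFun (fun v => pAdd N z S (A v) (B v)) :=
    DefFun.comp₂ h.definable_add
  refine h.ind (fun n => pAdd N z S (S m) n = S (pAdd N z S m n)) ?_ (fun n hn h' => ?_) n hn
  · rw [h.add_zero hm, h.add_zero (h.succ_mem m hm)]
  · rw [h.add_succ (h.succ_mem m hm) hn, h.add_succ hm hn, h']

theorem add_assoc {l m n : M} (hl : l ∈ N) (hm : m ∈ N) (hn : n ∈ N) :
    pAdd N z S (pAdd N z S l m) n = pAdd N z S l (pAdd N z S m n) := by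
  have iA : ∀ {A B : (ℕ → M) → M} [DefFun A] [DefFun B], DefFun (fun v => pAdd N z S (A v) (B v)) :=
    DefFun.comp₂ h.definable_add
  refine h.ind (fun n => pAdd N z S (pAdd N z S l m) n = pAdd N z S l (pAdd N z S m n)) ?_
    (fun n hn h' => ?_) n hn
  · rw [h.add_zero hm, h.add_zero (h.add_mem hl hm)]
  · rw [h.add_succ (h.add_mem hl hm) hn, h.add_succ hm hn, h.add_succ hl (h.add_mem hm hn), h']

theorem cases {n : M} (hn : n ∈ N) : n = z ∨ ∃ k ∈ N, n = S k := by
  have iS : ∀ {A : (ℕ → M) → M} [DefFun A], DefFun (fun v => S (A v)) := DefFun.comp₁ h.definable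
  exact h.ind (fun n => n = z ∨ ∃ k ∈ N, n = S k) (Or.inl rfl)
    (fun n hn _ => Or.inr ⟨n, hn, rfl⟩) n hn

theorem le_refl {m : M} (hm : m ∈ N) : pLe N z S m m := ⟨z, h.zero_mem, (h.add_zero hm).symm⟩

theorem zero_le {m : M} (hm : m ∈ N) : pLe N z S z m := ⟨m, hm, (h.zero_add hm).symm⟩

theorem le_trans {l m n : M} (hl : l ∈ N) (h1 : pLe N z S l m) (h2 : pLe N z S m n) :
    pLe N z S l n := by
  obtain ⟨j, hj, rfl⟩ := h1
  obtain ⟨k, hk, rfl⟩ := h2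
  exact ⟨_, h.add_mem hj hk, h.add_assoc hl hj hk⟩

theorem eq_or_succ_le {m n : M} (hm : m ∈ N) (hmn : pLe N z S m n) :
    n = m ∨ pLe N z S (S m) n := by
  obtain ⟨k, hk, rfl⟩ := hmn
  rcases h.cases hk with rfl | ⟨j, hj, rfl⟩
  · exact Or.inl (h.add_zero hm)
  · exact Or.inr ⟨j, hj, by rw [h.succ_add hm hj, h.add_succ hm hj]⟩

theorem not_succ_le {m : M} (hm : m ∈ N) : ¬ pLe N z S (S m) m := by
  rintro ⟨k, hk, hmk⟩
  have iS : ∀ {A : (ℕ → M) → M} [DefFun A], DefFun (fun v => S (A v)) := DefFun.comp₁ h.definable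
  have iA : ∀ {A B : (ℕ → M) → M} [DefFun A] [DefFun B], DefFun (fun v => pAdd N z S (A v) (B v)) :=
    DefFun.comp₂ h.definable_add
  refine h.ind (fun m => m ≠ pAdd N z S (S m) k) ?_ (fun m hm h' h'' => h' ?_) m hm hmk
  · rw [h.succ_add h.zero_mem hk]
    exact (h.succ_ne _ (h.add_mem h.zero_mem hk)).symm
  · rw [h.succ_add (h.succ_mem m hm) hk] at h''
    exact h.succ_inj _ hm _ (h.add_mem (h.succ_mem m hm) hk) h''

theorem le_antisymm {m n : M} (hm : m ∈ N) (hmn : pLe N z S m n) (hnm : pLe N z S n m) :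
    m = n := by
  rcases h.eq_or_succ_le hm hmn with h' | h'
  · exact h'.symm
  · exact absurd (h.le_trans (h.succ_mem m hm) h' hnm) (h.not_succ_le hm)

theorem exists_least {X : M} (hX : X ⊆ N) (hne : ∃ n, n ∈ X) :
    ∃ n ∈ X, ∀ m ∈ X, pLe N z S n m := by
  have iL : ∀ {A B : (ℕ → M) → M} [DefFun A] [DefFun B], DefPred (fun v => pLe N z S (A v) (B v)) :=
    DefPred.comp₂ h.definable_le
  by_contra hcon
  push Not at hcon
  obtain ⟨n, hn⟩ := hne
  have := h.ind (fun n => ∀ m ∈ X, pLe N z S n m) (fun m hm => h.zero_le (hX m hm)) ?_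
    (S n) (h.succ_mem n (hX n hn)) n hn
  · exact h.not_succ_le (hX n hn) this
  · intro k hk hle m hm
    rcases h.eq_or_succ_le hk (hle m hm) with rfl | h'
    · obtain ⟨l, hl, hml⟩ := hcon m hm
      exact absurd (hle l hl) hml
    · exact h'

theorem le_total {m n : M} (hm : m ∈ N) (hn : n ∈ N) : pLe N z S m n ∨ pLe N z S n m := by
  obtain ⟨l, hl, hle⟩ := h.exists_least (X := upair m n)
    (by intro l hl; rcases mem_upair.1 hl with rfl | rfl <;> assumption) ⟨m, by simp⟩
  rcases mem_upair.1 hl with rfl | rfl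
  · exact Or.inl (hle n (by simp))
  · exact Or.inr (hle m (by simp))

theorem definable_cantorNext : DefPred (fun v : ℕ → M => v 0 = cantorNext N z S (v 1)) := by
  have iS : ∀ {A : (ℕ → M) → M} [DefFun A], DefFun (fun v => S (A v)) := DefFun.comp₁ h.definable
  unfold cantorNext
  infer_instance

theorem cantorNext_zero {n : M} : cantorNext N z S (opair n z) = opair z (S n) := by
  refine the_eq (Or.inl (by simp)) fun q hq => ?_
  rcases hq with hq | ⟨k, hk, hq⟩
  · simpa using hq.2
  · exact absurd hq.1.symm (by simpa using h.succ_ne k hk)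

theorem cantorNext_succ {n m : M} (hm : m ∈ N) :
    cantorNext N z S (opair n (S m)) = opair (S n) m := by
  refine the_eq (Or.inr ⟨m, hm, by simp⟩) fun q hq => ?_
  rcases hq with hq | ⟨k, hk, hq⟩
  · exact absurd hq.1 (by simpa using h.succ_ne m hm)
  · rw [snd_opair, fst_opair] at hq
    rw [hq.2, h.succ_inj _ hm _ hk hq.1]

theorem cantorNext_mem : ∀ p ∈ prod N N, cantorNext N z S p ∈ prod N N := by
  intro p hp
  obtain ⟨n, hn, m, hm, rfl⟩ := mem_prod.1 hp
  rcases h.cases hm with rfl | ⟨k, hk, rfl⟩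
  · rw [h.cantorNext_zero]
    simp [h.zero_mem, h.succ_mem n hn]
  · rw [h.cantorNext_succ hk]
    simp [hk, h.succ_mem n hn]

theorem cantorNext_ne : ∀ p ∈ prod N N, cantorNext N z S p ≠ opair z z := by
  intro p hp
  obtain ⟨n, hn, m, hm, rfl⟩ := mem_prod.1 hp
  rcases h.cases hm with rfl | ⟨k, hk, rfl⟩
  · rw [h.cantorNext_zero]
    simp [h.succ_ne n hn]
  · rw [h.cantorNext_succ hk]
    simp [h.succ_ne n hn]

theorem cantorNext_inj : ∀ p ∈ prod N N, ∀ q ∈ prod N N,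
    cantorNext N z S p = cantorNext N z S q → p = q := by
  intro p hp q hq
  obtain ⟨n, hn, m, hm, rfl⟩ := mem_prod.1 hp
  obtain ⟨n', hn', m', hm', rfl⟩ := mem_prod.1 hq
  rcases h.cases hm with rfl | ⟨k, hk, rfl⟩ <;> rcases h.cases hm' with rfl | ⟨k', hk', rfl⟩
  · rw [h.cantorNext_zero, h.cantorNext_zero, opair_inj]
    rintro ⟨-, h'⟩
    rw [h.succ_inj _ hn _ hn' h']
  · rw [h.cantorNext_zero, h.cantorNext_succ hk', opair_inj]
    rintro ⟨h', -⟩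
    exact absurd h'.symm (h.succ_ne n' hn')
  · rw [h.cantorNext_zero, h.cantorNext_succ hk, opair_inj]
    rintro ⟨h', -⟩
    exact absurd h' (h.succ_ne n hn)
  · rw [h.cantorNext_succ hk, h.cantorNext_succ hk', opair_inj]
    rintro ⟨h', rfl⟩
    rw [h.succ_inj _ hn _ hn' h']

/-- Iterating `cantorNext` from `(z, z)` enumerates `N × N` without repetitions, so the inverse of
the enumeration is an injection of `N × N` into `N`. -/
theorem exists_pairing : ∃ f, IsInjFun f (prod N N) N := by
  have iA : ∀ {A B : (ℕ → M) → M} [DefFun A] [DefFun B], DefFun (fun v => pAdd N z S (A v) (B v)) :=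
    DefFun.comp₂ h.definable_add
  obtain ⟨c0, cS, cm⟩ := h.rec_spec h.definable_cantorNext
    (opair_mem_prod.2 ⟨h.zero_mem, h.zero_mem⟩) h.cantorNext_mem
  set r := recGraph N z S (prod N N) (cantorNext N z S) (opair z z)
  -- the enumeration reaches `(n, m)` if it reaches the start `(0, m + n)` of the diagonal
  have down : ∀ n ∈ N, ∀ m ∈ N, (∃ k ∈ N, app r k = opair z (pAdd N z S m n)) →
      ∃ k ∈ N, app r k = opair n m := by
    refine h.ind _ (fun m hm hk => ?_) fun n hn ih m hm hk => ?_
    · rwa [h.add_zero hm] at hk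
    · rw [h.add_succ hm hn, ← h.succ_add hm hn] at hk
      obtain ⟨k, hk, hkr⟩ := ih (S m) (h.succ_mem m hm) hk
      exact ⟨S k, h.succ_mem k hk, by rw [cS k hk, hkr, h.cantorNext_succ hm]⟩
  have top : ∀ n ∈ N, ∃ k ∈ N, app r k = opair z n := by
    refine h.ind _ ⟨z, h.zero_mem, c0⟩ fun n hn hk => ?_
    rw [← h.zero_add hn] at hk
    obtain ⟨k, hk, hkr⟩ := down n hn z h.zero_mem hk
    exact ⟨S k, h.succ_mem k hk, by rw [cS k hk, hkr, h.cantorNext_zero]⟩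
  have inj : ∀ i ∈ N, ∀ j ∈ N, app r i = app r j → i = j := by
    refine h.ind _ (fun j hj hij => ?_) fun i hi ih j hj hij => ?_
    · rcases h.cases hj with rfl | ⟨k, hk, rfl⟩
      · rfl
      · rw [c0, cS k hk] at hij
        exact absurd hij.symm (h.cantorNext_ne _ (cm k hk))
    · rcases h.cases hj with rfl | ⟨k, hk, rfl⟩
      · rw [c0, cS i hi] at hij
        exact absurd hij (h.cantorNext_ne _ (cm i hi))
      · rw [cS i hi, cS k hk] at hij
        rw [ih k hk (h.cantorNext_inj _ (cm i hi) _ (cm k hk) hij)]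
  refine ⟨sep (prod (prod N N) N) fun p => app r (snd p) = fst p, ?_, ?_, ?_, ?_⟩
  · exact fun p hp => (mem_sep.1 hp).1
  · intro p hp
    obtain ⟨n, hn, m, hm, rfl⟩ := mem_prod.1 hp
    obtain ⟨k, hk, hkr⟩ := down n hn m hm (top _ (h.add_mem hm hn))
    exact ⟨k, by simp [hn, hm, hk, hkr]⟩
  · intro p k l h1 h2
    simp only [mem_sep, opair_mem_prod, fst_opair, snd_opair] at h1 h2
    exact inj k h1.1.2 l h2.1.2 (h1.2.trans h2.2.symm)
  · intro p q k h1 h2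
    simp only [mem_sep, opair_mem_prod, fst_opair, snd_opair] at h1 h2
    exact h1.2.symm.trans h2.2

end Peano
end

section
variable {M : Type} [setLang.Structure M] [hM : M ⊨ ZF] [Nonempty M]

/-! ### Matchings -/

/-- The set of two-element subsets of `x`. -/
noncomputable def twoSub (x : M) : M :=
  sep (pow x) fun p => ∃ a ∈ x, ∃ b ∈ x, a ≠ b ∧ p = upair a b

theorem mem_twoSub {x p : M} : p ∈ twoSub x ↔ ∃ a ∈ x, ∃ b ∈ x, a ≠ b ∧ p = upair a b := by
  rw [twoSub, mem_sep, and_iff_right_iff_imp]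
  rintro ⟨a, ha, b, hb, -, rfl⟩
  rw [mem_pow]
  intro z hz
  rcases mem_upair.1 hz with rfl | rfl <;> assumption

/-- `Z` is a matching of `x`: a set of pairwise disjoint two-element subsets of `x`. -/
def IsMatching (x Z : M) : Prop := Z ⊆ twoSub x ∧ ∀ p ∈ Z, ∀ q ∈ Z, ∀ v ∈ p, v ∈ q → p = q

instance {F : (ℕ → M) → M} [DefFun F] : DefFun (fun v => twoSub (F v)) :=
  DefFun.comp₁ (by unfold twoSub; infer_instance)

instance {F G : (ℕ → M) → M} [DefFun F] [DefFun G] : DefPred (fun v => IsMatching (F v) (G v)) :=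
  DefPred.comp₂ (by unfold IsMatching; infer_instance)

theorem IsMatching.mono {x Z Z' : M} (h : IsMatching x Z) (hZ : Z' ⊆ Z) : IsMatching x Z' :=
  ⟨fun p hp => h.1 p (hZ p hp), fun p hp q hq => h.2 p (hZ p hp) q (hZ q hq)⟩

theorem isMatching_empty (x : M) : IsMatching x empty :=
  ⟨fun p hp => absurd hp (not_mem_empty p), fun p hp => absurd hp (not_mem_empty p)⟩

theorem isMatching_single {x p : M} (hp : p ∈ twoSub x) : IsMatching x (single p) :=
  ⟨fun q hq => by rw [mem_single.1 hq]; exact hp, fun q hq r hr _ _ _ => by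
    rw [mem_single.1 hq, mem_single.1 hr]⟩

/-- `e` restricts to an injection of the matchings of `x` into the two-element subsets of `x`.
Such a map exists whenever the permutations of `x` inject into `[x]²`; the goal is to refute it.
-/
structure MatchingInj (x : M) (e : M → M) : Prop where
  definable : DefPred (fun v : ℕ → M => v 0 = e (v 1))
  mem : ∀ Z, IsMatching x Z → e Z ∈ twoSub x
  inj : ∀ Z Z', IsMatching x Z → IsMatching x Z' → e Z = e Z' → Z = Z'

/-- The first of `A`, `B`, `A ∪ B` that has a chance of being a two-element subset of `x`: `A` or
`B` if one of them is, and `A ∪ B` otherwise. -/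
noncomputable def pickPair (x A B : M) : M :=
  the fun q => (A ∈ twoSub x ∧ q = A) ∨
    (¬ A ∈ twoSub x ∧ ((B ∈ twoSub x ∧ q = B) ∨ (¬ B ∈ twoSub x ∧ q = cup A B)))

instance {F G H : (ℕ → M) → M} [DefFun F] [DefFun G] [DefFun H] :
    DefFun (fun v => pickPair (F v) (G v) (H v)) :=
  ⟨have : DefFun (fun w : ℕ → M => F fun i => w (i + 1)) := DefFun.rename _
   have : DefFun (fun w : ℕ → M => F fun i => w (i + 1 + 1)) := DefFun.rename _
   have : DefFun (fun w : ℕ → M => G fun i => w (i + 1 + 1)) := DefFun.rename _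
   have : DefFun (fun w : ℕ → M => H fun i => w (i + 1 + 1)) := DefFun.rename _
   have : DefFun (fun w : ℕ → M => pickPair (F fun i => w (i + 1)) (G fun i => w (i + 1))
      (H fun i => w (i + 1))) := by unfold pickPair; infer_instance
   inferInstance⟩

theorem pickPair_cases (x A B : M) : (A ∈ twoSub x ∧ pickPair x A B = A) ∨
    (¬ A ∈ twoSub x ∧ ((B ∈ twoSub x ∧ pickPair x A B = B) ∨
      (¬ B ∈ twoSub x ∧ pickPair x A B = cup A B))) := by
  by_cases hA : A ∈ twoSub x
  · exact Or.inl ⟨hA, the_eq (Or.inl ⟨hA, rfl⟩) (by tauto)⟩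
  · by_cases hB : B ∈ twoSub x
    · exact Or.inr ⟨hA, Or.inl ⟨hB, the_eq (Or.inr ⟨hA, Or.inl ⟨hB, rfl⟩⟩) (by tauto)⟩⟩
    · exact Or.inr ⟨hA, Or.inr ⟨hB, the_eq (Or.inr ⟨hA, Or.inr ⟨hB, rfl⟩⟩) (by tauto)⟩⟩

/-- A pair not contained in `U` leaves either a pair or a singleton outside `U`. -/
theorem diff_twoSub {x p U : M} (hp : p ∈ twoSub x) (hpU : ¬ p ⊆ U) :
    diff p U ∈ twoSub x ∨ ∃ u ∈ x, diff p U = single u := by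
  obtain ⟨a, ha, b, hb, hab, rfl⟩ := mem_twoSub.1 hp
  by_cases haU : a ∈ U
  · refine Or.inr ⟨b, hb, ext_mem fun z => ?_⟩
    have hbU : ¬ b ∈ U := fun h => hpU fun z hz => by
      rcases mem_upair.1 hz with rfl | rfl <;> assumption
    rw [mem_diff, mem_upair, mem_single]
    constructor
    · rintro ⟨rfl | rfl, h⟩
      · exact absurd haU h
      · rfl
    · rintro rfl
      exact ⟨Or.inr rfl, hbU⟩
  · by_cases hbU : b ∈ U
    · refine Or.inr ⟨a, ha, ext_mem fun z => ?_⟩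
      rw [mem_diff, mem_upair, mem_single]
      constructor
      · rintro ⟨rfl | rfl, h⟩
        · rfl
        · exact absurd hbU h
      · rintro rfl
        exact ⟨Or.inl rfl, haU⟩
    · left
      have : diff (upair a b) U = upair a b := ext_mem fun z => by
        rw [mem_diff, and_iff_left_iff_imp]
        intro hz
        rcases mem_upair.1 hz with rfl | rfl <;> assumption
      rwa [this]

/-- Two edges are enough to find, without choice, a pair disjoint from `U`: `p` has a point
outside `U`; if it has only one, `q` has a point outside `U` different from that one. -/
theorem pickPair_spec {x U p q : M} (hp : p ∈ twoSub x) (hpU : ¬ p ⊆ U) (hq : q ∈ twoSub x)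
    (hqU : ¬ q ⊆ cup U (diff p U)) :
    pickPair x (diff p U) (diff q U) ∈ twoSub x ∧
      ∀ v ∈ pickPair x (diff p U) (diff q U), ¬ v ∈ U := by
  have hqU' : ¬ q ⊆ U := fun h => hqU fun z hz => mem_cup.2 (Or.inl (h z hz))
  rcases pickPair_cases x (diff p U) (diff q U) with ⟨h, he⟩ | ⟨h, ⟨h', he⟩ | ⟨h', he⟩⟩
  · rw [he]
    exact ⟨h, fun v hv => (mem_diff.1 hv).2⟩
  · rw [he]
    exact ⟨h', fun v hv => (mem_diff.1 hv).2⟩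
  · rw [he]
    refine ⟨?_, fun v hv => ?_⟩
    · obtain ⟨u, hu, hue⟩ := (diff_twoSub hp hpU).resolve_left h
      obtain ⟨w, hw, hwe⟩ := (diff_twoSub hq hqU').resolve_left h'
      refine mem_twoSub.2 ⟨u, hu, w, hw, ?_, ext_mem fun z => by simp [hue, hwe]⟩
      rintro rfl
      refine hqU fun z hz => ?_
      rw [hue, ← hwe, mem_cup, mem_diff]
      tauto
    · rcases mem_cup.1 hv with hv | hv <;> exact (mem_diff.1 hv).2

/-- `R` is a well-order of `D` as a reflexive relation. Totality and transitivity follow from the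
existence of least elements and antisymmetry. -/
def IsWellOrder (D R : M) : Prop := R ⊆ prod D D ∧ (∀ a b, opair a b ∈ R → opair b a ∈ R → a = b) ∧
  ∀ X, X ⊆ D → (∃ a, a ∈ X) → ∃ a ∈ X, ∀ b ∈ X, opair a b ∈ R

instance {F G : (ℕ → M) → M} [DefFun F] [DefFun G] : DefPred (fun v => IsWellOrder (F v) (G v)) :=
  DefPred.comp₂ (by unfold IsWellOrder; infer_instance)

/-! ### The Peano system of an injection of matchings -/

/-- The least set of edges containing `e ∅` and closed under `p ↦ e {p}`. -/
noncomputable def orbit (x : M) (e : M → M) : M :=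
  sep (twoSub x) fun n => ∀ X : M, e empty ∈ X → (∀ p ∈ X, e (single p) ∈ X) → n ∈ X

theorem twoSub_ne_empty {x p : M} (hp : p ∈ twoSub x) : ∃ v, v ∈ p := by
  obtain ⟨a, ha, b, hb, hab, rfl⟩ := mem_twoSub.1 hp
  exact ⟨a, by simp⟩

theorem MatchingInj.orbit_subset {x : M} {e : M → M} (he : MatchingInj x e) :
    orbit x e ⊆ twoSub x := by
  have ie : ∀ {A : (ℕ → M) → M} [DefFun A], DefFun (fun v => e (A v)) := DefFun.comp₁ he.definable
  exact fun n hn => (mem_sep.1 hn).1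

/-- Injectivity of `e` makes the orbit of `e ∅` under `p ↦ e {p}` a Peano system of edges. -/
theorem MatchingInj.peano {x : M} {e : M → M} (he : MatchingInj x e) :
    Peano (orbit x e) (e empty) (fun p => e (single p)) := by
  have ie : ∀ {A : (ℕ → M) → M} [DefFun A], DefFun (fun v => e (A v)) := DefFun.comp₁ he.definable
  have hN : ∀ n, n ∈ orbit x e ↔ n ∈ twoSub x ∧ ∀ X : M, e empty ∈ X →
    (∀ p ∈ X, e (single p) ∈ X) → n ∈ X := fun n => mem_sep
  have h2 : ∀ n ∈ orbit x e, n ∈ twoSub x := fun n hn => ((hN n).1 hn).1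
  have h0 : e empty ∈ orbit x e := (hN _).2 ⟨he.mem _ (isMatching_empty x), fun X h _ => h⟩
  have hS : ∀ n ∈ orbit x e, e (single n) ∈ orbit x e := fun n hn =>
    (hN _).2 ⟨he.mem _ (isMatching_single (h2 n hn)), fun X h h' => h' n (((hN n).1 hn).2 X h h')⟩
  refine ⟨inferInstance, h0, hS, fun m hm n hn h => ?_, fun n hn h => ?_, fun X hz hX n hn => ?_⟩
  · have := he.inj _ _ (isMatching_single (h2 m hm)) (isMatching_single (h2 n hn)) h
    have h' : m ∈ single n := this ▸ mem_single.2 rfl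
    exact mem_single.1 h'
  · have := he.inj _ _ (isMatching_single (h2 n hn)) (isMatching_empty x) h
    exact not_mem_empty n (this ▸ mem_single.2 rfl)
  · have := ((hN n).1 hn).2 (sep (orbit x e) fun n => n ∈ X) (mem_sep.2 ⟨h0, hz⟩)
      fun n hn => mem_sep.2 ⟨hS n (mem_sep.1 hn).1, hX n (mem_sep.1 hn).1 (mem_sep.1 hn).2⟩
    exact (mem_sep.1 this).2

/-! ### Tame sets of points -/

/-- `V` contains only boundedly many of the edges in `N`, and this persists when one point is
added: for every `a` the edges in `N` joining `a` to `V` are bounded as well. This invariant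
replaces finiteness of `V`. -/
def Tame (N z : M) (S : M → M) (V : M) : Prop :=
  (∃ k ∈ N, ∀ n ∈ N, n ⊆ V → pLe N z S n k) ∧
    ∀ a, ∃ k ∈ N, ∀ n ∈ N, (∃ v ∈ V, n = upair a v) → pLe N z S n k

/-- The least edge in `N` not contained in `V`, in the order of the Peano system. -/
noncomputable def leastEdge (N z : M) (S : M → M) (V : M) : M :=
  the fun n => n ∈ N ∧ ¬ n ⊆ V ∧ ∀ m ∈ N, ¬ m ⊆ V → pLe N z S n m

namespace Peano
variable {N z : M} {S : M → M} (h : Peano N z S) {x : M} (hN : N ⊆ twoSub x)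
include h

theorem definable_tame : DefPred (fun v : ℕ → M => Tame N z S (v 0)) := by
  have iL : ∀ {A B : (ℕ → M) → M} [DefFun A] [DefFun B], DefPred (fun v => pLe N z S (A v) (B v)) :=
    DefPred.comp₂ h.definable_le
  unfold Tame
  infer_instance

theorem definable_leastEdge : DefPred (fun v : ℕ → M => v 0 = leastEdge N z S (v 1)) := by
  have iL : ∀ {A B : (ℕ → M) → M} [DefFun A] [DefFun B], DefPred (fun v => pLe N z S (A v) (B v)) :=
    DefPred.comp₂ h.definable_le
  unfold leastEdge
  infer_instance

theorem exists_bound {k l : M} (hk : k ∈ N) (hl : l ∈ N) {P Q : M → Prop}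
    (hP : ∀ n ∈ N, P n → pLe N z S n k) (hQ : ∀ n ∈ N, Q n → pLe N z S n l) :
    ∃ m ∈ N, ∀ n ∈ N, P n ∨ Q n → pLe N z S n m := by
  rcases h.le_total hk hl with hkl | hkl
  · refine ⟨l, hl, fun n hn hPQ => ?_⟩
    rcases hPQ with h' | h'
    · exact h.le_trans hn (hP n hn h') hkl
    · exact hQ n hn h'
  · refine ⟨k, hk, fun n hn hPQ => ?_⟩
    rcases hPQ with h' | h'
    · exact hP n hn h'
    · exact h.le_trans hn (hQ n hn h') hkl

include hN

theorem tame_empty : Tame N z S (empty : M) := by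
  refine ⟨⟨z, h.zero_mem, fun n hn hne => ?_⟩, fun a => ⟨z, h.zero_mem, ?_⟩⟩
  · obtain ⟨v, hv⟩ := twoSub_ne_empty (hN n hn)
    exact absurd (hne v hv) (not_mem_empty v)
  · rintro n - ⟨v, hv, -⟩
    exact absurd hv (not_mem_empty v)

theorem tame_insert {V : M} (hV : Tame N z S V) (b : M) : Tame N z S (cup V (single b)) := by
  obtain ⟨⟨k, hk, hkV⟩, hV'⟩ := hV
  refine ⟨?_, fun a => ?_⟩
  · obtain ⟨l, hl, hlV⟩ := hV' b
    obtain ⟨m, hm, hmV⟩ := h.exists_bound hk hl hkV hlV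
    refine ⟨m, hm, fun n hn hnV => hmV n hn ?_⟩
    obtain ⟨c, hc, d, hd, hcd, rfl⟩ := mem_twoSub.1 (hN n hn)
    have h1 := hnV c (by simp)
    have h2 := hnV d (by simp)
    rw [mem_cup, mem_single] at h1 h2
    rcases h1 with h1 | rfl
    · rcases h2 with h2 | rfl
      · left
        intro v hv
        rcases mem_upair.1 hv with rfl | rfl <;> assumption
      · exact Or.inr ⟨c, h1, upair_comm _ _⟩
    · rcases h2 with h2 | rfl
      · exact Or.inr ⟨d, h2, rfl⟩
      · exact absurd rfl hcd
  · obtain ⟨l, hl, hlV⟩ := hV' a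
    by_cases hab : upair a b ∈ N
    · obtain ⟨m, hm, hmV⟩ := h.exists_bound (Q := fun n => n = upair a b) hl hab hlV
        (by rintro n hn rfl; exact h.le_refl hn)
      refine ⟨m, hm, ?_⟩
      rintro n hn ⟨v, hv, rfl⟩
      rw [mem_cup, mem_single] at hv
      rcases hv with hv | rfl
      · exact hmV _ hn (Or.inl ⟨v, hv, rfl⟩)
      · exact hmV _ hn (Or.inr rfl)
    · refine ⟨l, hl, ?_⟩
      rintro n hn ⟨v, hv, rfl⟩
      rw [mem_cup, mem_single] at hv
      rcases hv with hv | rfl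
      · exact hlV _ hn ⟨v, hv, rfl⟩
      · exact absurd hn hab

theorem tame_cup_pair {V p : M} (hV : Tame N z S V) (hp : p ∈ twoSub x) : Tame N z S (cup V p) := by
  obtain ⟨a, -, b, -, -, rfl⟩ := mem_twoSub.1 hp
  have : cup V (upair a b) = cup (cup V (single a)) (single b) :=
    ext_mem fun v => by simp [or_assoc]
  rw [this]
  exact h.tame_insert hN (h.tame_insert hN hV a) b

theorem leastEdge_spec {V : M} (hV : Tame N z S V) :
    leastEdge N z S V ∈ N ∧ ¬ leastEdge N z S V ⊆ V := by
  obtain ⟨k, hk, hkV⟩ := hV.1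
  obtain ⟨n, hn, hle⟩ := h.exists_least (X := sep N fun n => ¬ n ⊆ V)
    (fun n hn => (mem_sep.1 hn).1) ⟨S k, mem_sep.2 ⟨h.succ_mem k hk, fun h' =>
      h.not_succ_le hk (hkV _ (h.succ_mem k hk) h')⟩⟩
  simp only [mem_sep] at hn hle
  have : leastEdge N z S V = n := the_eq ⟨hn.1, hn.2, fun m hm hm' => hle m ⟨hm, hm'⟩⟩
    fun m hm => h.le_antisymm hm.1 (hm.2.2 n hn.1 hn.2) (hle m ⟨hm.1, hm.2.1⟩)
  rw [this]
  exact hn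

end Peano
end

section
variable {M : Type} [setLang.Structure M] [hM : M ⊨ ZF] [Nonempty M]

/-! ### An infinite well-ordered matching -/

/-- A pair disjoint from the tame set `V`, formed from the first edges of `N` that are not
covered. -/
noncomputable def nextPair (N z : M) (S : M → M) (x V : M) : M :=
  pickPair x (diff (leastEdge N z S V) V)
    (diff (leastEdge N z S (cup V (diff (leastEdge N z S V) V))) V)

namespace Peano
variable {N z : M} {S : M → M} (h : Peano N z S) {x : M} (hN : N ⊆ twoSub x)
include h

theorem definable_nextPair : DefPred (fun v : ℕ → M => v 0 = nextPair N z S x (v 1)) := by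
  have iE : ∀ {A : (ℕ → M) → M} [DefFun A], DefFun (fun v => leastEdge N z S (A v)) :=
    DefFun.comp₁ h.definable_leastEdge
  unfold nextPair
  infer_instance

theorem iterate_mem (k : ℕ) : S^[k] z ∈ N := by
  induction k with
  | zero => exact h.zero_mem
  | succ k ih => rw [Function.iterate_succ_apply']; exact h.succ_mem _ ih

theorem iterate_inj : Function.Injective fun k : ℕ => S^[k] z := by
  intro i j hij
  induction i generalizing j with
  | zero =>
    cases j with
    | zero => rfl
    | succ j =>
      simp only [Function.iterate_succ_apply'] at hij
      exact absurd hij.symm (h.succ_ne _ (h.iterate_mem j))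
  | succ i ih =>
    cases j with
    | zero =>
      simp only [Function.iterate_succ_apply'] at hij
      exact absurd hij (h.succ_ne _ (h.iterate_mem i))
    | succ j =>
      simp only [Function.iterate_succ_apply'] at hij
      rw [ih (h.succ_inj _ (h.iterate_mem i) _ (h.iterate_mem j) hij)]

include hN

theorem nextPair_spec {V : M} (hV : Tame N z S V) :
    nextPair N z S x V ∈ twoSub x ∧ ∀ v ∈ nextPair N z S x V, ¬ v ∈ V := by
  obtain ⟨h1, h2⟩ := h.leastEdge_spec hN hV
  have hV' : Tame N z S (cup V (diff (leastEdge N z S V) V)) := by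
    rcases diff_twoSub (hN _ h1) h2 with h3 | ⟨u, -, h3⟩
    · exact h.tame_cup_pair hN hV h3
    · rw [h3]
      exact h.tame_insert hN hV u
  obtain ⟨h3, h4⟩ := h.leastEdge_spec hN hV'
  exact pickPair_spec (hN _ h1) h2 (hN _ h3) h4

/-- A sequence of disjoint pairs indexed by `N`: start with `V = ∅` and repeatedly add
`nextPair V` to `V`, which stays tame. -/
theorem exists_seq : ∃ d : M → M, DefPred (fun v : ℕ → M => v 0 = d (v 1)) ∧
    (∀ n ∈ N, d n ∈ twoSub x) ∧
    ∀ m ∈ N, ∀ n ∈ N, ∀ v ∈ d m, v ∈ d n → m = n := by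
  have iA : ∀ {A B : (ℕ → M) → M} [DefFun A] [DefFun B], DefFun (fun v => pAdd N z S (A v) (B v)) :=
    DefFun.comp₂ h.definable_add
  have iN : ∀ {A : (ℕ → M) → M} [DefFun A], DefFun (fun v => nextPair N z S x (A v)) :=
    DefFun.comp₁ h.definable_nextPair
  have iT : ∀ {A : (ℕ → M) → M} [DefFun A], DefPred (fun v => Tame N z S (A v)) :=
    DefPred.comp₁ h.definable_tame
  let step : M → M := fun V => cup V (nextPair N z S x V)
  have dstep : DefPred (fun v : ℕ → M => v 0 = step (v 1)) := by simp only [step]; infer_instance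
  let Y : M := sep (pow x) fun V => Tame N z S V
  have hY : ∀ V, V ∈ Y ↔ V ⊆ x ∧ Tame N z S V := fun V => by simp only [Y, mem_sep, mem_pow]
  have hstep : ∀ V ∈ Y, step V ∈ Y := by
    intro V hV
    obtain ⟨h1, h2⟩ := (hY V).1 hV
    obtain ⟨h3, h4⟩ := h.nextPair_spec hN h2
    refine (hY _).2 ⟨fun v hv => ?_, h.tame_cup_pair hN h2 h3⟩
    rcases mem_cup.1 hv with hv | hv
    · exact h1 v hv
    · obtain ⟨a, ha, b, hb, hab, he⟩ := mem_twoSub.1 h3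
      rw [he] at hv
      rcases mem_upair.1 hv with rfl | rfl <;> assumption
  obtain ⟨W0, WS, WY⟩ := h.rec_spec dstep (y := empty)
    ((hY _).2 ⟨fun v hv => absurd hv (not_mem_empty v), h.tame_empty hN⟩) hstep
  set r := recGraph N z S Y step empty
  have mono : ∀ m ∈ N, ∀ k ∈ N, app r m ⊆ app r (pAdd N z S m k) := by
    intro m hm
    refine h.ind _ ?_ fun k hk hmk => ?_
    · rw [h.add_zero hm]
      exact fun v hv => hv
    · rw [h.add_succ hm hk, WS _ (h.add_mem hm hk)]
      exact fun v hv => mem_cup.2 (Or.inl (hmk v hv))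
  have lt : ∀ m ∈ N, ∀ n ∈ N, pLe N z S m n → m ≠ n → ∀ v ∈ nextPair N z S x (app r m),
      ¬ v ∈ nextPair N z S x (app r n) := by
    intro m hm n hn hmn hne v hv hv'
    obtain ⟨k, hk, rfl⟩ := (h.eq_or_succ_le hm hmn).resolve_left fun h' => hne h'.symm
    refine (h.nextPair_spec hN ((hY _).1 (WY _ hn)).2).2 v hv' (mono _ (h.succ_mem m hm) k hk v ?_)
    rw [WS m hm]
    exact mem_cup.2 (Or.inr hv)
  refine ⟨fun n => nextPair N z S x (app r n), inferInstance,
    fun n hn => (h.nextPair_spec hN ((hY _).1 (WY _ hn)).2).1, fun m hm n hn v hv hv' => ?_⟩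
  by_contra hne
  rcases h.le_total hm hn with h' | h'
  · exact lt m hm n hn h' hne v hv hv'
  · exact lt n hn m hm h' (Ne.symm hne) v hv' hv

/-- The range of the sequence of `exists_seq`, with the order and the pairing function of `N`
transported to it, and its first five members. -/
theorem exists_base : ∃ (D R f : M) (τ : Fin 5 → M), Function.Injective τ ∧ (∀ k, τ k ∈ D) ∧
    IsMatching x D ∧ IsWellOrder D R ∧ IsInjFun f (prod D D) D := by
  obtain ⟨d, hd, d2, dd⟩ := h.exists_seq hN
  have iL : ∀ {A B : (ℕ → M) → M} [DefFun A] [DefFun B], DefPred (fun v => pLe N z S (A v) (B v)) :=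
    DefPred.comp₂ h.definable_le
  have id : ∀ {A : (ℕ → M) → M} [DefFun A], DefFun (fun v => d (A v)) := DefFun.comp₁ hd
  have dinj : ∀ m ∈ N, ∀ n ∈ N, d m = d n → m = n := fun m hm n hn hmn => by
    obtain ⟨v, hv⟩ := twoSub_ne_empty (d2 m hm)
    exact dd m hm n hn v hv (hmn ▸ hv)
  obtain ⟨c, hc⟩ := h.exists_pairing
  let D : M := sep (twoSub x) fun p => ∃ n ∈ N, p = d n
  have hD : ∀ p, p ∈ D ↔ ∃ n ∈ N, p = d n := fun p => by
    simp only [D, mem_sep, and_iff_right_iff_imp]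
    rintro ⟨n, hn, rfl⟩
    exact d2 n hn
  have dD : ∀ n ∈ N, d n ∈ D := fun n hn => (hD _).2 ⟨n, hn, rfl⟩
  let R : M := sep (prod D D) fun p => ∃ m ∈ N, ∃ n ∈ N, p = opair (d m) (d n) ∧ pLe N z S m n
  have hR : ∀ m ∈ N, ∀ n ∈ N, opair (d m) (d n) ∈ R ↔ pLe N z S m n := fun m hm n hn => by
    simp only [R, mem_sep, opair_mem_prod]
    constructor
    · rintro ⟨-, m', hm', n', hn', he, hle⟩
      obtain ⟨h1, h2⟩ := opair_inj.1 he
      obtain rfl := dinj _ hm _ hm' h1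
      obtain rfl := dinj _ hn _ hn' h2
      exact hle
    · exact fun hle => ⟨⟨dD m hm, dD n hn⟩, m, hm, n, hn, rfl, hle⟩
  have hRD : R ⊆ prod D D := fun p hp => (mem_sep.1 hp).1
  let f : M := sep (prod (prod D D) D) fun p => ∃ m ∈ N, ∃ n ∈ N, ∃ k ∈ N,
    p = opair (opair (d m) (d n)) (d k) ∧ opair (opair m n) k ∈ c
  have hf : ∀ q p, opair q p ∈ f ↔ ∃ m ∈ N, ∃ n ∈ N, ∃ k ∈ N, q = opair (d m) (d n) ∧ p = d k ∧
      opair (opair m n) k ∈ c := fun q p => by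
    simp only [f, mem_sep, opair_inj, and_assoc, and_iff_right_iff_imp]
    rintro ⟨m, hm, n, hn, k, hk, rfl, rfl, -⟩
    simp [dD m hm, dD n hn, dD k hk]
  refine ⟨D, R, f, fun k => d (S^[k] z), ?_, fun k => dD _ (h.iterate_mem k), ⟨?_, ?_⟩,
    ⟨hRD, ?_, ?_⟩, ⟨fun p hp => (mem_sep.1 hp).1, ?_, ?_, ?_⟩⟩
  · intro i j hij
    exact Fin.ext (h.iterate_inj (dinj _ (h.iterate_mem i) _ (h.iterate_mem j) hij))
  · exact fun p hp => (mem_sep.1 hp).1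
  · intro p hp q hq v hv hv'
    obtain ⟨m, hm, rfl⟩ := (hD p).1 hp
    obtain ⟨n, hn, rfl⟩ := (hD q).1 hq
    rw [dd m hm n hn v hv hv']
  · intro a b hab hba
    obtain ⟨ha, hb⟩ := opair_mem_prod.1 (hRD _ hab)
    obtain ⟨m, hm, rfl⟩ := (hD a).1 ha
    obtain ⟨n, hn, rfl⟩ := (hD b).1 hb
    rw [h.le_antisymm hm ((hR m hm n hn).1 hab) ((hR n hn m hm).1 hba)]
  · intro X hX ⟨p, hp⟩
    obtain ⟨m, hm, rfl⟩ := (hD p).1 (hX p hp)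
    obtain ⟨n, hn, hle⟩ := h.exists_least (X := sep N fun n => d n ∈ X)
      (fun n hn => (mem_sep.1 hn).1) ⟨m, mem_sep.2 ⟨hm, hp⟩⟩
    refine ⟨d n, (mem_sep.1 hn).2, fun q hq => ?_⟩
    obtain ⟨k, hk, rfl⟩ := (hD q).1 (hX q hq)
    exact (hR n (mem_sep.1 hn).1 k hk).2 (hle k (mem_sep.2 ⟨hk, hq⟩))
  · intro q hq
    obtain ⟨a, ha, b, hb, rfl⟩ := mem_prod.1 hq
    obtain ⟨m, hm, rfl⟩ := (hD a).1 ha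
    obtain ⟨n, hn, rfl⟩ := (hD b).1 hb
    have hmn : opair m n ∈ prod N N := opair_mem_prod.2 ⟨hm, hn⟩
    exact ⟨d (app c (opair m n)), (hf _ _).2 ⟨m, hm, n, hn, _, hc.app_mem hmn, rfl, rfl,
      hc.opair_app hmn⟩⟩
  · intro q p p' h1 h2
    obtain ⟨m, hm, n, hn, k, hk, rfl, rfl, h3⟩ := (hf _ _).1 h1
    obtain ⟨m', hm', n', hn', k', hk', he, rfl, h4⟩ := (hf _ _).1 h2
    obtain ⟨he1, he2⟩ := opair_inj.1 he
    obtain rfl := dinj _ hm _ hm' he1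
    obtain rfl := dinj _ hn _ hn' he2
    rw [hc.func _ _ _ h3 h4]
  · intro q q' p h1 h2
    obtain ⟨m, hm, n, hn, k, hk, rfl, rfl, h3⟩ := (hf _ _).1 h1
    obtain ⟨m', hm', n', hn', k', hk', rfl, he, h4⟩ := (hf _ _).1 h2
    obtain rfl := dinj _ hk _ hk' he
    obtain ⟨rfl, rfl⟩ := opair_inj.1 (hc.inj _ _ _ h3 h4)
    rfl

end Peano

theorem MatchingInj.exists_base {x : M} {e : M → M} (he : MatchingInj x e) :
    ∃ (D R f : M) (τ : Fin 5 → M), Function.Injective τ ∧ (∀ k, τ k ∈ D) ∧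
      IsMatching x D ∧ IsWellOrder D R ∧ IsInjFun f (prod D D) D :=
  he.peano.exists_base he.orbit_subset

end

section
variable {M : Type} [setLang.Structure M] [hM : M ⊨ ZF] [Nonempty M]

/-! ### The diagonal submatching -/

/-- For codes `i`, `j` the pairs `t 0 i j, …, t 4 i j` serve as five reserved coordinates of a
submatching. The pattern "only the `k`-th coordinate belongs to `Z`" is blocked if some `Z ⊆ D`
with this pattern has an image `e Z = {a, b}` with `a` coded by `i` and `b` coded by `j`. -/
def Blocks (e : M → M) (D : M) (Code : M → M → Prop) (t : Fin 5 → M → M → M) (i j : M)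
    (k : Fin 5) : Prop :=
  ∃ Z, Z ⊆ D ∧ ∃ a b, Code a i ∧ Code b j ∧ e Z = upair a b ∧ ∀ k', t k' i j ∈ Z ↔ k' = k

/-- The submatching of `D` that has on the coordinates of `(i, j)` the first pattern that is not
blocked (and contains none of them if all patterns are blocked). -/
noncomputable def diagSet (e : M → M) (D C : M) (Code : M → M → Prop) (t : Fin 5 → M → M → M) : M :=
  sep D fun d => ∃ i j, ∃ k : Fin 5, i ∈ C ∧ j ∈ C ∧ d = t k i j ∧ ¬ Blocks e D Code t i j k ∧
    ∀ k', k' < k → Blocks e D Code t i j k'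

/-- Cantor's diagonal argument. If every point of `U` has a code and a code belongs to at most two
points, the image of the diagonal submatching is an edge not contained in `U`: otherwise it would
be coded by some `(i, j)`, and the pattern chosen for `(i, j)` would be blocked by `diagSet`
itself. A pattern that is not blocked exists, as `(i, j)` codes at most four edges and there are
five patterns. -/
theorem diagSet_spec {x D C U : M} {e : M → M} (he : MatchingInj x e) {Code : M → M → Prop}
    {t : Fin 5 → M → M → M} (dCode : DefPred (fun v : ℕ → M => Code (v 0) (v 1)))
    (dt : ∀ k, DefPred (fun v : ℕ → M => v 0 = t k (v 1) (v 2))) (hD : IsMatching x D)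
    (hCode : ∀ v i, Code v i → i ∈ C)
    (hfib : ∀ i a b c, Code a i → Code b i → Code c i → a = b ∨ a = c ∨ b = c)
    (ht : ∀ k, ∀ i ∈ C, ∀ j ∈ C, t k i j ∈ D)
    (htinj : ∀ k k', ∀ i ∈ C, ∀ j ∈ C, ∀ i' ∈ C, ∀ j' ∈ C, t k i j = t k' i' j' →
      k = k' ∧ i = i' ∧ j = j')
    (hU : ∀ v ∈ U, ∃ i, Code v i) :
    diagSet e D C Code t ⊆ D ∧ ¬ e (diagSet e D C Code t) ⊆ U := by
  have ie : ∀ {A : (ℕ → M) → M} [DefFun A], DefFun (fun v => e (A v)) := DefFun.comp₁ he.definable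
  have iC : ∀ {A B : (ℕ → M) → M} [DefFun A] [DefFun B], DefPred (fun v => Code (A v) (B v)) :=
    DefPred.comp₂ dCode
  have it : ∀ {k} {A B : (ℕ → M) → M} [DefFun A] [DefFun B], DefFun (fun v => t k (A v) (B v)) :=
    fun {k} => DefFun.comp₂ (dt k)
  have iB : ∀ {k} {A B : (ℕ → M) → M} [DefFun A] [DefFun B],
      DefPred (fun v => Blocks e D Code t (A v) (B v) k) :=
    fun {k} => DefPred.comp₂ (R := fun i j => Blocks e D Code t i j k) (by
      unfold Blocks; infer_instance)
  have hA : ∀ d, d ∈ diagSet e D C Code t ↔ d ∈ D ∧ ∃ i j, ∃ k : Fin 5, i ∈ C ∧ j ∈ C ∧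
    d = t k i j ∧ ¬ Blocks e D Code t i j k ∧ ∀ k', k' < k → Blocks e D Code t i j k' :=
    fun d => mem_sep
  set A := diagSet e D C Code t
  have hAD : A ⊆ D := fun d hd => ((hA d).1 hd).1
  refine ⟨hAD, fun hAU => ?_⟩
  obtain ⟨a, -, b, -, -, hab⟩ := mem_twoSub.1 (he.mem A (hD.mono hAD))
  obtain ⟨i, hi⟩ := hU a (hAU a (hab ▸ by simp))
  obtain ⟨j, hj⟩ := hU b (hAU b (hab ▸ by simp))
  have hiC := hCode _ _ hi
  have hjC := hCode _ _ hj
  -- five sets with five different patterns cannot all be mapped into the at most four edges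
  have hex : ∃ k, ¬ Blocks e D Code t i j k := by
    by_contra hcon
    push Not at hcon
    choose Z hZ a' b' ha' hb' heZ hpat using hcon
    classical
    have hlt : Fintype.card (Bool × Bool) < Fintype.card (Fin 5) := by decide
    obtain ⟨k, k', hne, hkk⟩ := Fintype.exists_ne_map_eq_of_card_lt
      (fun k : Fin 5 => (decide (a' k = a' 0), decide (b' k = b' 0))) hlt
    simp only [Prod.mk.injEq, decide_eq_decide] at hkk
    have h1 : a' k = a' k' := by
      rcases hfib i _ _ _ (ha' k) (ha' k') (ha' 0) with h | h | h
      · exact h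
      · rw [h, hkk.1.1 h]
      · rw [h, hkk.1.2 h]
    have h2 : b' k = b' k' := by
      rcases hfib j _ _ _ (hb' k) (hb' k') (hb' 0) with h | h | h
      · exact h
      · rw [h, hkk.2.1 h]
      · rw [h, hkk.2.2 h]
    have hZZ : Z k = Z k' := he.inj _ _ (hD.mono (hZ k)) (hD.mono (hZ k'))
      (by rw [heZ, heZ, h1, h2])
    exact hne (((hpat k' k).1 (hZZ ▸ (hpat k k).2 rfl)))
  classical
  obtain ⟨k, hk, hmin⟩ : ∃ k, ¬ Blocks e D Code t i j k ∧
      ∀ k', k' < k → Blocks e D Code t i j k' := by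
    obtain ⟨k, hk, hmin⟩ := WellFounded.has_min (wellFounded_lt (α := Fin 5))
      {k | ¬ Blocks e D Code t i j k} hex
    exact ⟨k, hk, fun k' hk' => by_contra fun h => hmin k' h hk'⟩
  refine hk ⟨A, hAD, a, b, hi, hj, hab, fun k' => ?_⟩
  rw [hA]
  constructor
  · rintro ⟨-, i', j', l, hi', hj', he', hl, hlmin⟩
    obtain ⟨rfl, rfl, rfl⟩ := htinj _ _ _ hiC _ hjC _ hi' _ hj' he'
    rcases lt_trichotomy k' k with h | h | h
    · exact absurd (hmin k' h) hl
    · exact h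
    · exact absurd (hlmin k h) hk
  · rintro rfl
    exact ⟨ht _ _ hiC _ hjC, i, j, k', hiC, hjC, rfl, hk, hmin⟩

/-! ### States of the transfinite construction -/

/-- The tuple consisting of a matching `D`, its core `C`, an order `R`, a pairing `H` and a mate
map `G`. -/
noncomputable def mkState (D C R H G : M) : M := opair D (opair C (opair R (opair H G)))

/-- The matching of a state. -/
noncomputable def stMatching (s : M) : M := fst s

/-- The core of a state, the part of the matching closed under the pairing function. -/
noncomputable def stCore (s : M) : M := fst (snd s)

/-- The well-order of the matching of a state. -/
noncomputable def stOrder (s : M) : M := fst (snd (snd s))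

/-- The pairing function of the core of a state. -/
noncomputable def stPairing (s : M) : M := fst (snd (snd (snd s)))

/-- The injection of a state from the part of the matching outside the core into the core. -/
noncomputable def stMate (s : M) : M := snd (snd (snd (snd s)))

section
variable {F : (ℕ → M) → M} [DefFun F]
instance : DefFun (fun v => stMatching (F v)) := by unfold stMatching; infer_instance
instance : DefFun (fun v => stCore (F v)) := by unfold stCore; infer_instance
instance : DefFun (fun v => stOrder (F v)) := by unfold stOrder; infer_instance
instance : DefFun (fun v => stPairing (F v)) := by unfold stPairing; infer_instance
instance : DefFun (fun v => stMate (F v)) := by unfold stMate; infer_instance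
instance {F₁ F₂ F₃ F₄ F₅ : (ℕ → M) → M}
    [DefFun F₁] [DefFun F₂] [DefFun F₃] [DefFun F₄] [DefFun F₅] :
    DefFun (fun v => mkState (F₁ v) (F₂ v) (F₃ v) (F₄ v) (F₅ v)) := by
  unfold mkState; infer_instance
end

section
variable (D C R H G : M)
@[simp] theorem stMatching_mk : stMatching (mkState D C R H G) = D := by simp [stMatching, mkState]
@[simp] theorem stCore_mk : stCore (mkState D C R H G) = C := by simp [stCore, mkState]
@[simp] theorem stOrder_mk : stOrder (mkState D C R H G) = R := by simp [stOrder, mkState]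
@[simp] theorem stPairing_mk : stPairing (mkState D C R H G) = H := by simp [stPairing, mkState]
@[simp] theorem stMate_mk : stMate (mkState D C R H G) = G := by simp [stMate, mkState]
end

/-- A state: a well-ordered matching `D` of `x` with a core `C ⊆ D` containing five fixed tags, an
injection `C × C → C` and an injection `D \ C → C`. The last two take the place of a choice of
injections `α × α → α` for all infinite ordinals `α`: while the matching grows the pairing
function is left alone, and it is extended to the whole matching once the mates exhaust the core.
-/
structure IsState (x : M) (τ : Fin 5 → M) (s : M) : Prop where
  eta : s = mkState (stMatching s) (stCore s) (stOrder s) (stPairing s) (stMate s)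
  mat : IsMatching x (stMatching s)
  wo : IsWellOrder (stMatching s) (stOrder s)
  sub : stCore s ⊆ stMatching s
  tag : ∀ k, τ k ∈ stCore s
  pairing : IsInjFun (stPairing s) (prod (stCore s) (stCore s)) (stCore s)
  inj : IsInjFun (stMate s) (diff (stMatching s) (stCore s)) (stCore s)

theorem isState_iff {x : M} {τ : Fin 5 → M} {s : M} : IsState x τ s ↔
    s = mkState (stMatching s) (stCore s) (stOrder s) (stPairing s) (stMate s) ∧
    IsMatching x (stMatching s) ∧ IsWellOrder (stMatching s) (stOrder s) ∧
    stCore s ⊆ stMatching s ∧ (∀ k, τ k ∈ stCore s) ∧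
    IsInjFun (stPairing s) (prod (stCore s) (stCore s)) (stCore s) ∧
    IsInjFun (stMate s) (diff (stMatching s) (stCore s)) (stCore s) :=
  ⟨fun h => ⟨h.1, h.2, h.3, h.4, h.5, h.6, h.7⟩,
    fun h => ⟨h.1, h.2.1, h.2.2.1, h.2.2.2.1, h.2.2.2.2.1, h.2.2.2.2.2.1, h.2.2.2.2.2.2⟩⟩

instance {x : M} {τ : Fin 5 → M} {F : (ℕ → M) → M} [DefFun F] :
    DefPred (fun v => IsState x τ (F v)) :=
  DefPred.comp₁ (R := fun s => IsState x τ s) (by simp only [isState_iff]; infer_instance)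

/-- The set of all states of `x` with tags `τ`. -/
noncomputable def states (x : M) (τ : Fin 5 → M) : M :=
  sep (prod (pow (twoSub x)) (prod (pow (twoSub x)) (prod (pow (prod (twoSub x) (twoSub x)))
    (prod (pow (prod (prod (twoSub x) (twoSub x)) (twoSub x)))
      (pow (prod (twoSub x) (twoSub x))))))) fun s => IsState x τ s

theorem prod_mono {a b c d : M} (h : a ⊆ c) (h' : b ⊆ d) : prod a b ⊆ prod c d := by
  intro p hp
  obtain ⟨y, hy, z, hz, rfl⟩ := mem_prod.1 hp
  exact opair_mem_prod.2 ⟨h y hy, h' z hz⟩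

theorem subset_trans' {a b c : M} (h : a ⊆ b) (h' : b ⊆ c) : a ⊆ c := fun z hz => h' z (h z hz)

theorem mem_states {x : M} {τ : Fin 5 → M} {s : M} : s ∈ states x τ ↔ IsState x τ s := by
  rw [states, mem_sep, and_iff_right_iff_imp]
  intro h
  have hC := subset_trans' h.sub h.mat.1
  rw [h.eta]
  simp only [mkState, opair_mem_prod, mem_pow]
  exact ⟨h.mat.1, hC, subset_trans' h.wo.1 (prod_mono h.mat.1 h.mat.1),
    subset_trans' h.pairing.sub (prod_mono (prod_mono hC hC) hC),
    subset_trans' h.inj.sub (prod_mono (fun p hp => h.mat.1 p (mem_diff.1 hp).1) hC)⟩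

/-- The order of states: `t` end-extends the well-order of `s` and extends its pairing function,
and either the cores agree and the mate map is extended, or the core of `t` contains the whole
matching of `s`. In the second case the mate map of `s` has become obsolete. -/
structure StateLE (s t : M) : Prop where
  matching : stMatching s ⊆ stMatching t
  order : stOrder s ⊆ stOrder t
  endExt : ∀ a, ∀ b ∈ stMatching s, opair a b ∈ stOrder t → opair a b ∈ stOrder s
  core : stCore s ⊆ stCore t
  pairing : stPairing s ⊆ stPairing t
  mate : (stCore s = stCore t ∧ stMate s ⊆ stMate t) ∨ stMatching s ⊆ stCore t

theorem stateLE_iff {s t : M} : StateLE s t ↔ stMatching s ⊆ stMatching t ∧ stOrder s ⊆ stOrder t ∧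
    (∀ a, ∀ b ∈ stMatching s, opair a b ∈ stOrder t → opair a b ∈ stOrder s) ∧
    stCore s ⊆ stCore t ∧ stPairing s ⊆ stPairing t ∧
    ((stCore s = stCore t ∧ stMate s ⊆ stMate t) ∨ stMatching s ⊆ stCore t) :=
  ⟨fun h => ⟨h.1, h.2, h.3, h.4, h.5, h.6⟩,
    fun h => ⟨h.1, h.2.1, h.2.2.1, h.2.2.2.1, h.2.2.2.2.1, h.2.2.2.2.2⟩⟩

theorem definable_stateLE : DefPred (fun v : ℕ → M => StateLE (v 0) (v 1)) := by
  simp only [stateLE_iff]; infer_instance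

theorem subset_antisymm' {a b : M} (h : a ⊆ b) (h' : b ⊆ a) : a = b :=
  ext_mem fun z => ⟨h z, h' z⟩

theorem stateLE_refl (s : M) : StateLE s s :=
  ⟨fun _ h => h, fun _ h => h, fun _ _ _ h => h, fun _ h => h, fun _ h => h,
    Or.inl ⟨rfl, fun _ h => h⟩⟩

theorem stateLE_trans {s t u : M} (h : StateLE s t) (h' : StateLE t u) : StateLE s u := by
  refine ⟨subset_trans' h.matching h'.matching, subset_trans' h.order h'.order,
    fun a b hb hab => h.endExt a b hb (h'.endExt a b (h.matching b hb) hab),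
    subset_trans' h.core h'.core, subset_trans' h.pairing h'.pairing, ?_⟩
  rcases h.mate with ⟨h1, h2⟩ | h1
  · rcases h'.mate with ⟨h3, h4⟩ | h3
    · exact Or.inl ⟨h1.trans h3, subset_trans' h2 h4⟩
    · exact Or.inr (subset_trans' h.matching h3)
  · exact Or.inr (subset_trans' h1 h'.core)

theorem IsState.mate_eq_empty {x : M} {τ : Fin 5 → M} {s : M} (hs : IsState x τ s)
    (h : stMatching s ⊆ stCore s) : stMate s = empty := by
  refine ext_mem fun p => ⟨fun hp => ?_, fun hp => absurd hp (not_mem_empty p)⟩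
  obtain ⟨a, ha, b, -, rfl⟩ := mem_prod.1 (hs.inj.sub p hp)
  rw [mem_diff] at ha
  exact absurd (h a ha.1) ha.2

theorem stateLE_antisymm {x : M} {τ : Fin 5 → M} {s t : M} (hs : IsState x τ s) (ht : IsState x τ t)
    (h : StateLE s t) (h' : StateLE t s) : s = t := by
  have hD := subset_antisymm' h.matching h'.matching
  have hC := subset_antisymm' h.core h'.core
  have hG : stMate s = stMate t := by
    rcases h.mate with ⟨-, h1⟩ | h1
    · rcases h'.mate with ⟨-, h2⟩ | h2
      · exact subset_antisymm' h1 h2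
      · rw [← hD] at h2
        rw [hs.mate_eq_empty h2, ht.mate_eq_empty (by rwa [← hD, ← hC])]
    · rw [← hC] at h1
      rw [hs.mate_eq_empty h1, ht.mate_eq_empty (by rwa [← hD, ← hC])]
  rw [hs.eta, ht.eta, hD, hC, subset_antisymm' h.order h'.order,
    subset_antisymm' h.pairing h'.pairing, hG]

end

section
variable {M : Type} [setLang.Structure M] [hM : M ⊨ ZF] [Nonempty M]

/-! ### Suprema of chains of states -/

/-- The union of the matchings of the states in `K`. -/
noncomputable def supMatching (x K : M) : M := sep (twoSub x) fun p => ∃ s ∈ K, p ∈ stMatching s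

/-- The union of the cores of the states in `K`. -/
noncomputable def supCore (x K : M) : M := sep (twoSub x) fun p => ∃ s ∈ K, p ∈ stCore s

/-- The union of the well-orders of the states in `K`. -/
noncomputable def supOrder (x K : M) : M :=
  sep (prod (twoSub x) (twoSub x)) fun p => ∃ s ∈ K, p ∈ stOrder s

/-- The union of the pairing functions of the states in `K`. -/
noncomputable def supPairing (x K : M) : M :=
  sep (prod (prod (twoSub x) (twoSub x)) (twoSub x)) fun p => ∃ s ∈ K, p ∈ stPairing s

/-- The union of the mate maps of the states in `K`, restricted to the complement of the new core:
on that complement any two of them agree. -/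
noncomputable def supMate (x K : M) : M :=
  sep (prod (twoSub x) (twoSub x)) fun p => (∃ s ∈ K, p ∈ stMate s) ∧ ¬ fst p ∈ supCore x K

/-- The supremum of a chain `K` of states of `x`. -/
noncomputable def stateSup (x K : M) : M :=
  mkState (supMatching x K) (supCore x K) (supOrder x K) (supPairing x K) (supMate x K)

instance {x : M} {F : (ℕ → M) → M} [DefFun F] : DefFun (fun v => supCore x (F v)) := by
  unfold supCore
  exact DefFun.comp₁ (R := fun K => sep (twoSub x) fun p => ∃ s ∈ K, p ∈ stCore s) inferInstance

theorem definable_stateSup (x : M) : DefPred (fun v : ℕ → M => v 0 = stateSup x (v 1)) := by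
  unfold stateSup supMatching supOrder supPairing supMate
  infer_instance

section
variable {x : M} {τ : Fin 5 → M} {K : M} (hK : IsChainIn (states x τ) StateLE K)
include hK

theorem IsChainIn.isState {s : M} (hs : s ∈ K) : IsState x τ s := mem_states.1 (hK.1 s hs)

theorem IsChainIn.directed {s t : M} (hs : s ∈ K) (ht : t ∈ K) :
    ∃ u ∈ K, StateLE s u ∧ StateLE t u := by
  rcases hK.2.2 s hs t ht with h | h
  · exact ⟨t, ht, h, stateLE_refl t⟩
  · exact ⟨s, hs, stateLE_refl s, h⟩

theorem IsChainIn.mem_supMatching {p : M} : p ∈ supMatching x K ↔ ∃ s ∈ K, p ∈ stMatching s := by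
  rw [supMatching, mem_sep, and_iff_right_iff_imp]
  rintro ⟨s, hs, hp⟩
  exact (hK.isState hs).mat.1 p hp

theorem IsChainIn.mem_supCore {p : M} : p ∈ supCore x K ↔ ∃ s ∈ K, p ∈ stCore s := by
  rw [supCore, mem_sep, and_iff_right_iff_imp]
  rintro ⟨s, hs, hp⟩
  exact (hK.isState hs).mat.1 p ((hK.isState hs).sub p hp)

theorem IsChainIn.mem_supOrder {p : M} : p ∈ supOrder x K ↔ ∃ s ∈ K, p ∈ stOrder s := by
  rw [supOrder, mem_sep, and_iff_right_iff_imp]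
  rintro ⟨s, hs, hp⟩
  have h := hK.isState hs
  exact prod_mono h.mat.1 h.mat.1 p (h.wo.1 p hp)

theorem IsChainIn.mem_supPairing {p : M} : p ∈ supPairing x K ↔ ∃ s ∈ K, p ∈ stPairing s := by
  rw [supPairing, mem_sep, and_iff_right_iff_imp]
  rintro ⟨s, hs, hp⟩
  have h := hK.isState hs
  have hC := subset_trans' h.sub h.mat.1
  exact prod_mono (prod_mono hC hC) hC p (h.pairing.sub p hp)

theorem IsChainIn.mem_supMate {a b : M} :
    opair a b ∈ supMate x K ↔ (∃ s ∈ K, opair a b ∈ stMate s) ∧ ¬ a ∈ supCore x K := by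
  rw [supMate, mem_sep, fst_opair, and_iff_right_iff_imp]
  rintro ⟨⟨s, hs, hp⟩, -⟩
  have h := hK.isState hs
  obtain ⟨h1, h2⟩ := opair_mem_prod.1 (h.inj.sub _ hp)
  exact opair_mem_prod.2 ⟨h.mat.1 a (mem_diff.1 h1).1, h.mat.1 b (h.sub b h2)⟩

theorem IsChainIn.exists_mem_of_mem_supMate {p : M} (hp : p ∈ supMate x K) :
    ∃ s ∈ K, p ∈ stMate s := (mem_sep.1 hp).2.1

/-- If `a` and `b` never enter the core, the mate maps of two states whose matchings contain them
have a common extension in the chain. -/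
theorem IsChainIn.mate_directed {s t a b : M} (hs : s ∈ K) (ht : t ∈ K) (ha : a ∈ stMatching s)
    (hb : b ∈ stMatching t) (ha' : ¬ a ∈ supCore x K) (hb' : ¬ b ∈ supCore x K) :
    ∃ u ∈ K, stMate s ⊆ stMate u ∧ stMate t ⊆ stMate u := by
  rcases hK.2.2 s hs t ht with h | h
  · rcases h.mate with ⟨-, h'⟩ | h'
    · exact ⟨t, ht, h', fun _ h => h⟩
    · exact absurd (hK.mem_supCore.2 ⟨t, ht, h' a ha⟩) ha'
  · rcases h.mate with ⟨-, h'⟩ | h'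
    · exact ⟨s, hs, fun _ h => h, h'⟩
    · exact absurd (hK.mem_supCore.2 ⟨s, hs, h' b hb⟩) hb'

theorem IsChainIn.supOrder_isWellOrder : IsWellOrder (supMatching x K) (supOrder x K) := by
  refine ⟨fun p hp => ?_, fun a b hab hba => ?_, fun X hX ⟨p, hp⟩ => ?_⟩
  · obtain ⟨s, hs, hp⟩ := hK.mem_supOrder.1 hp
    have := fun p (hp : p ∈ stMatching s) => hK.mem_supMatching.2 ⟨s, hs, hp⟩
    exact prod_mono this this p ((hK.isState hs).wo.1 p hp)
  · obtain ⟨s, hs, hab⟩ := hK.mem_supOrder.1 hab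
    obtain ⟨t, ht, hba⟩ := hK.mem_supOrder.1 hba
    obtain ⟨u, hu, hsu, htu⟩ := hK.directed hs ht
    exact (hK.isState hu).wo.2.1 a b (hsu.order _ hab) (htu.order _ hba)
  · obtain ⟨s, hs, hps⟩ := hK.mem_supMatching.1 (hX p hp)
    obtain ⟨m, hm, hmin⟩ := (hK.isState hs).wo.2.2 (sep X fun q => q ∈ stMatching s)
      (fun q hq => (mem_sep.1 hq).2) ⟨p, mem_sep.2 ⟨hp, hps⟩⟩
    obtain ⟨hmX, hms⟩ := mem_sep.1 hm
    refine ⟨m, hmX, fun q hq => ?_⟩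
    obtain ⟨t, ht, hqt⟩ := hK.mem_supMatching.1 (hX q hq)
    obtain ⟨u, hu, hsu, htu⟩ := hK.directed hs ht
    obtain ⟨l, hl, hlmin⟩ := (hK.isState hu).wo.2.2 (upair m q)
      (fun w hw => by
        rcases mem_upair.1 hw with rfl | rfl
        · exact hsu.matching _ hms
        · exact htu.matching _ hqt) ⟨m, by simp⟩
    rcases mem_upair.1 hl with rfl | rfl
    · exact hK.mem_supOrder.2 ⟨u, hu, hlmin q (by simp)⟩
    · have h1 := hsu.endExt l m hms (hlmin m (by simp))
      have h2 := (opair_mem_prod.1 ((hK.isState hs).wo.1 _ h1)).1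
      exact hK.mem_supOrder.2 ⟨s, hs, hmin l (mem_sep.2 ⟨hq, h2⟩)⟩

theorem IsChainIn.supPairing_isInjFun :
    IsInjFun (supPairing x K) (prod (supCore x K) (supCore x K)) (supCore x K) := by
  refine ⟨fun p hp => ?_, fun p hp => ?_, fun a b c hab hac => ?_, fun a b c hac hbc => ?_⟩
  · obtain ⟨s, hs, hp⟩ := hK.mem_supPairing.1 hp
    have := fun p (hp : p ∈ stCore s) => hK.mem_supCore.2 ⟨s, hs, hp⟩
    exact prod_mono (prod_mono this this) this p ((hK.isState hs).pairing.sub p hp)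
  · obtain ⟨a, ha, b, hb, rfl⟩ := mem_prod.1 hp
    obtain ⟨s, hs, ha⟩ := hK.mem_supCore.1 ha
    obtain ⟨t, ht, hb⟩ := hK.mem_supCore.1 hb
    obtain ⟨u, hu, hsu, htu⟩ := hK.directed hs ht
    obtain ⟨c, hc⟩ := (hK.isState hu).pairing.total (opair a b)
      (opair_mem_prod.2 ⟨hsu.core a ha, htu.core b hb⟩)
    exact ⟨c, hK.mem_supPairing.2 ⟨u, hu, hc⟩⟩
  · obtain ⟨s, hs, hab⟩ := hK.mem_supPairing.1 hab
    obtain ⟨t, ht, hac⟩ := hK.mem_supPairing.1 hac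
    obtain ⟨u, hu, hsu, htu⟩ := hK.directed hs ht
    exact (hK.isState hu).pairing.func a b c (hsu.pairing _ hab) (htu.pairing _ hac)
  · obtain ⟨s, hs, hac⟩ := hK.mem_supPairing.1 hac
    obtain ⟨t, ht, hbc⟩ := hK.mem_supPairing.1 hbc
    obtain ⟨u, hu, hsu, htu⟩ := hK.directed hs ht
    exact (hK.isState hu).pairing.inj a b c (hsu.pairing _ hac) (htu.pairing _ hbc)

theorem IsChainIn.mate_dom {s a b : M} (hs : s ∈ K) (h : opair a b ∈ stMate s) :
    a ∈ stMatching s ∧ ¬ a ∈ stCore s ∧ b ∈ stCore s := by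
  have h := opair_mem_prod.1 ((hK.isState hs).inj.sub _ h)
  exact ⟨(mem_diff.1 h.1).1, (mem_diff.1 h.1).2, h.2⟩

theorem IsChainIn.supMate_isInjFun :
    IsInjFun (supMate x K) (diff (supMatching x K) (supCore x K)) (supCore x K) := by
  refine ⟨fun p hp => ?_, fun a ha => ?_, fun a b c hab hac => ?_, fun a b c hac hbc => ?_⟩
  · obtain ⟨s, hs, hps⟩ := hK.exists_mem_of_mem_supMate hp
    obtain ⟨a, ha, b, hb, rfl⟩ := mem_prod.1 ((hK.isState hs).inj.sub p hps)
    exact opair_mem_prod.2 ⟨mem_diff.2 ⟨hK.mem_supMatching.2 ⟨s, hs, (mem_diff.1 ha).1⟩,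
      (hK.mem_supMate.1 hp).2⟩, hK.mem_supCore.2 ⟨s, hs, hb⟩⟩
  · obtain ⟨ha, ha'⟩ := mem_diff.1 ha
    obtain ⟨s, hs, has⟩ := hK.mem_supMatching.1 ha
    obtain ⟨b, hb⟩ := (hK.isState hs).inj.total a
      (mem_diff.2 ⟨has, fun h => ha' (hK.mem_supCore.2 ⟨s, hs, h⟩)⟩)
    exact ⟨b, hK.mem_supMate.2 ⟨⟨s, hs, hb⟩, ha'⟩⟩
  · obtain ⟨⟨s, hs, h1⟩, h2⟩ := hK.mem_supMate.1 hab
    obtain ⟨⟨t, ht, h3⟩, -⟩ := hK.mem_supMate.1 hac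
    obtain ⟨u, hu, hsu, htu⟩ := hK.mate_directed hs ht (hK.mate_dom hs h1).1
      (hK.mate_dom ht h3).1 h2 h2
    exact (hK.isState hu).inj.func a b c (hsu _ h1) (htu _ h3)
  · obtain ⟨⟨s, hs, h1⟩, h2⟩ := hK.mem_supMate.1 hac
    obtain ⟨⟨t, ht, h3⟩, h4⟩ := hK.mem_supMate.1 hbc
    obtain ⟨u, hu, hsu, htu⟩ := hK.mate_directed hs ht (hK.mate_dom hs h1).1
      (hK.mate_dom ht h3).1 h2 h4
    exact (hK.isState hu).inj.inj a b c (hsu _ h1) (htu _ h3)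

theorem IsChainIn.isState_sup : IsState x τ (stateSup x K) := by
  constructor
  · simp [stateSup]
  · simp only [stateSup, stMatching_mk]
    refine ⟨fun p hp => (mem_sep.1 hp).1, fun p hp q hq => ?_⟩
    obtain ⟨s, hs, hp⟩ := hK.mem_supMatching.1 hp
    obtain ⟨t, ht, hq⟩ := hK.mem_supMatching.1 hq
    obtain ⟨u, hu, hsu, htu⟩ := hK.directed hs ht
    exact (hK.isState hu).mat.2 p (hsu.matching p hp) q (htu.matching q hq)
  · simpa only [stateSup, stMatching_mk, stOrder_mk] using hK.supOrder_isWellOrder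
  · simp only [stateSup, stMatching_mk, stCore_mk]
    intro p hp
    obtain ⟨s, hs, hp⟩ := hK.mem_supCore.1 hp
    exact hK.mem_supMatching.2 ⟨s, hs, (hK.isState hs).sub p hp⟩
  · simp only [stateSup, stCore_mk]
    intro k
    obtain ⟨s, hs⟩ := hK.2.1
    exact hK.mem_supCore.2 ⟨s, hs, (hK.isState hs).tag k⟩
  · simpa only [stateSup, stCore_mk, stPairing_mk] using hK.supPairing_isInjFun
  · simpa only [stateSup, stCore_mk, stMatching_mk, stMate_mk] using hK.supMate_isInjFun

theorem IsChainIn.le_sup {s : M} (hs : s ∈ K) : StateLE s (stateSup x K) := by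
  constructor <;> simp only [stateSup, stMatching_mk, stCore_mk, stOrder_mk, stPairing_mk,
    stMate_mk]
  · exact fun p hp => hK.mem_supMatching.2 ⟨s, hs, hp⟩
  · exact fun p hp => hK.mem_supOrder.2 ⟨s, hs, hp⟩
  · intro a b hb hab
    obtain ⟨t, ht, hab⟩ := hK.mem_supOrder.1 hab
    rcases hK.2.2 s hs t ht with h | h
    · exact h.endExt a b hb hab
    · exact h.order _ hab
  · exact fun p hp => hK.mem_supCore.2 ⟨s, hs, hp⟩
  · exact fun p hp => hK.mem_supPairing.2 ⟨s, hs, hp⟩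
  · by_cases hC : supCore x K ⊆ stCore s
    · refine Or.inl ⟨subset_antisymm' (fun p hp => hK.mem_supCore.2 ⟨s, hs, hp⟩) hC, fun p hp => ?_⟩
      obtain ⟨a, ha, b, -, rfl⟩ := mem_prod.1 ((hK.isState hs).inj.sub p hp)
      exact hK.mem_supMate.2 ⟨⟨s, hs, hp⟩, fun h => (mem_diff.1 ha).2 (hC a h)⟩
    · right
      simp only [subset_def] at hC
      push Not at hC
      obtain ⟨p, hp, hps⟩ := hC
      obtain ⟨t, ht, hp⟩ := hK.mem_supCore.1 hp
      rcases hK.2.2 s hs t ht with h | h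
      · rcases h.mate with ⟨h', -⟩ | h'
        · exact absurd (h' ▸ hp) hps
        · exact fun q hq => hK.mem_supCore.2 ⟨t, ht, h' q hq⟩
      · exact absurd (h.core p hp) hps

theorem IsChainIn.sup_le {u : M} (h : ∀ s ∈ K, StateLE s u) : StateLE (stateSup x K) u := by
  have hC : supCore x K ⊆ stCore u := fun p hp => by
    obtain ⟨s, hs, hp⟩ := hK.mem_supCore.1 hp
    exact (h s hs).core p hp
  constructor <;> simp only [stateSup, stMatching_mk, stCore_mk, stOrder_mk, stPairing_mk,
    stMate_mk]
  · intro p hp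
    obtain ⟨s, hs, hp⟩ := hK.mem_supMatching.1 hp
    exact (h s hs).matching p hp
  · intro p hp
    obtain ⟨s, hs, hp⟩ := hK.mem_supOrder.1 hp
    exact (h s hs).order p hp
  · intro a b hb hab
    obtain ⟨s, hs, hb⟩ := hK.mem_supMatching.1 hb
    exact hK.mem_supOrder.2 ⟨s, hs, (h s hs).endExt a b hb hab⟩
  · exact hC
  · intro p hp
    obtain ⟨s, hs, hp⟩ := hK.mem_supPairing.1 hp
    exact (h s hs).pairing p hp
  · by_cases hD : supMatching x K ⊆ stCore u
    · exact Or.inr hD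
    · left
      simp only [subset_def] at hD
      push Not at hD
      obtain ⟨p, hp, hpu⟩ := hD
      obtain ⟨s, hs, hp⟩ := hK.mem_supMatching.1 hp
      have hsC : stCore s = stCore u := by
        rcases (h s hs).mate with ⟨h', -⟩ | h'
        · exact h'
        · exact absurd (h' p hp) hpu
      have hCu : supCore x K = stCore u :=
        subset_antisymm' hC fun q hq => hK.mem_supCore.2 ⟨s, hs, hsC ▸ hq⟩
      refine ⟨hCu, fun q hq => ?_⟩
      obtain ⟨t, ht, hqt⟩ := hK.exists_mem_of_mem_supMate hq
      obtain ⟨a, ha, b, -, rfl⟩ := mem_prod.1 ((hK.isState ht).inj.sub q hqt)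
      rcases (h t ht).mate with ⟨-, h'⟩ | h'
      · exact h' _ hqt
      · exact absurd (hCu ▸ h' a (mem_diff.1 ha).1) (hK.mem_supMate.1 hq).2

end
end

section
variable {M : Type} [setLang.Structure M] [hM : M ⊨ ZF] [Nonempty M]

/-! ### Codes for points -/

/-- The value of the pairing function of a state. -/
noncomputable def pairCode (s a b : M) : M := app (stPairing s) (opair a b)

/-- The mate, in the core, of a pair outside the core. -/
noncomputable def coreMate (s a : M) : M := app (stMate s) a

instance {F G H : (ℕ → M) → M} [DefFun F] [DefFun G] [DefFun H] :
    DefFun (fun v => pairCode (F v) (G v) (H v)) := by unfold pairCode; infer_instance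
instance {F G : (ℕ → M) → M} [DefFun F] [DefFun G] :
    DefFun (fun v => coreMate (F v) (G v)) := by unfold coreMate; infer_instance

section
variable {x : M} {τ : Fin 5 → M} {s : M} (hs : IsState x τ s)
include hs

theorem IsState.pairCode_mem {a b : M} (ha : a ∈ stCore s) (hb : b ∈ stCore s) :
    pairCode s a b ∈ stCore s :=
  hs.pairing.app_mem (opair_mem_prod.2 ⟨ha, hb⟩)

theorem IsState.pairCode_inj {a b a' b' : M} (ha : a ∈ stCore s) (hb : b ∈ stCore s)
    (ha' : a' ∈ stCore s) (hb' : b' ∈ stCore s) (h : pairCode s a b = pairCode s a' b') :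
    a = a' ∧ b = b' :=
  opair_inj.1 (hs.pairing.app_inj (opair_mem_prod.2 ⟨ha, hb⟩) (opair_mem_prod.2 ⟨ha', hb'⟩) h)

theorem IsState.coreMate_mem {a : M} (ha : a ∈ stMatching s) (ha' : ¬ a ∈ stCore s) :
    coreMate s a ∈ stCore s :=
  hs.inj.app_mem (mem_diff.2 ⟨ha, ha'⟩)

theorem IsState.coreMate_inj {a b : M} (ha : a ∈ stMatching s) (ha' : ¬ a ∈ stCore s)
    (hb : b ∈ stMatching s) (hb' : ¬ b ∈ stCore s) (h : coreMate s a = coreMate s b) :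
    a = b :=
  hs.inj.app_inj (mem_diff.2 ⟨ha, ha'⟩) (mem_diff.2 ⟨hb, hb'⟩) h

end

/-! ### A pair disjoint from the matching of a state -/

/-- `i`, an element of the core of `s`, codes the point `v`. A point of a pair `p` of the matching
is coded by `p` itself, or by its mate if `p` lies outside the core, and the points of `W` have
one code in common; tags keep the three kinds of codes apart. -/
def CodeOf (τ : Fin 5 → M) (s W v i : M) : Prop :=
  (∃ p ∈ stMatching s, v ∈ p ∧ ((p ∈ stCore s ∧ i = pairCode s p (τ 0)) ∨
    (¬ p ∈ stCore s ∧ i = pairCode s (coreMate s p) (τ 1)))) ∨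
  (v ∈ W ∧ i = pairCode s (τ 0) (τ 2))

/-- The `k`-th reserved coordinate of the pair of codes `(i, j)`. -/
noncomputable def coord (τ : Fin 5 → M) (s : M) (k : Fin 5) (i j : M) : M :=
  pairCode s (pairCode s i j) (τ k)

/-- The image under `e` of the diagonal submatching: an edge not contained in `⋃ D ∪ W`. -/
noncomputable def freshEdge (e : M → M) (τ : Fin 5 → M) (s W : M) : M :=
  e (diagSet e (stMatching s) (stCore s) (CodeOf τ s W) (coord τ s))

/-- A pair disjoint from the matching of `s`, obtained from two fresh edges. The first has
`W = ∅`; if it contributes only one new point, then that point is the only element of the set `W`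
of the second. -/
noncomputable def newPair (x : M) (e : M → M) (τ : Fin 5 → M) (s : M) : M :=
  pickPair x (diff (freshEdge e τ s empty) (bigUnion (stMatching s)))
    (diff (freshEdge e τ s (diff (freshEdge e τ s empty) (bigUnion (stMatching s))))
      (bigUnion (stMatching s)))

section
variable {x : M} {e : M → M} (he : MatchingInj x e) {τ : Fin 5 → M}
include he

set_option synthInstance.maxHeartbeats 400000 in
set_option synthInstance.maxSize 2000 in
theorem definable_freshEdge : DefPred (fun v : ℕ → M => v 0 = freshEdge e τ (v 1) (v 2)) := by
  have ie : ∀ {A : (ℕ → M) → M} [DefFun A], DefFun (fun v => e (A v)) := DefFun.comp₁ he.definable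
  unfold freshEdge diagSet Blocks CodeOf coord
  infer_instance

theorem definable_newPair : DefPred (fun v : ℕ → M => v 0 = newPair x e τ (v 1)) := by
  have ie : ∀ {A B : (ℕ → M) → M} [DefFun A] [DefFun B],
      DefFun (fun v => freshEdge e τ (A v) (B v)) :=
    DefFun.comp₂ (definable_freshEdge he)
  unfold newPair
  infer_instance

variable (hτ : Function.Injective τ) {s : M} (hs : IsState x τ s)
include hτ hs

/-- The codes satisfy the hypotheses of the diagonal argument as long as `W` has at most one
point: two points with the same code lie in the same pair of the matching. -/
theorem freshEdge_spec {W : M} (hW : ∀ v ∈ W, ∀ w ∈ W, v = w) :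
    freshEdge e τ s W ∈ twoSub x ∧ ¬ freshEdge e τ s W ⊆ cup (bigUnion (stMatching s)) W := by
  have tag := hs.tag
  have tne : ∀ {k l : Fin 5}, k ≠ l → τ k ≠ τ l := fun h h' => h (hτ h')
  have key := diagSet_spec (C := stCore s) (U := cup (bigUnion (stMatching s)) W) he
    (Code := CodeOf τ s W) (t := coord τ s) (by unfold CodeOf; infer_instance)
    (fun k => by unfold coord; infer_instance) hs.mat ?_ ?_ ?_ ?_ ?_
  · exact ⟨he.mem _ (hs.mat.mono key.1), key.2⟩
  · rintro v i (⟨p, hp, -, ⟨hpC, rfl⟩ | ⟨hpC, rfl⟩⟩ | ⟨-, rfl⟩)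
    · exact hs.pairCode_mem hpC (tag 0)
    · exact hs.pairCode_mem (hs.coreMate_mem hp hpC) (tag 1)
    · exact hs.pairCode_mem (tag 0) (tag 2)
  · -- two points with the same code lie in the same pair or both in `W`
    have same : ∀ i a b, CodeOf τ s W a i → CodeOf τ s W b i →
        a = b ∨ ∃ p ∈ stMatching s, a ∈ p ∧ b ∈ p := by
      rintro i a b (⟨p, hp, hap, ⟨hpC, rfl⟩ | ⟨hpC, rfl⟩⟩ | ⟨haW, rfl⟩)
        (⟨q, hq, hbq, ⟨hqC, hi⟩ | ⟨hqC, hi⟩⟩ | ⟨hbW, hi⟩)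
      · obtain ⟨rfl, -⟩ := hs.pairCode_inj hpC (tag 0) hqC (tag 0) hi
        exact Or.inr ⟨p, hp, hap, hbq⟩
      · exact absurd (hs.pairCode_inj hpC (tag 0) (hs.coreMate_mem hq hqC) (tag 1) hi).2
          (tne (by decide))
      · exact absurd (hs.pairCode_inj hpC (tag 0) (tag 0) (tag 2) hi).2 (tne (by decide))
      · exact absurd (hs.pairCode_inj (hs.coreMate_mem hp hpC) (tag 1) hqC (tag 0) hi).2
          (tne (by decide))
      · obtain ⟨h, -⟩ := hs.pairCode_inj (hs.coreMate_mem hp hpC) (tag 1) (hs.coreMate_mem hq hqC)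
            (tag 1) hi
        obtain rfl := hs.coreMate_inj hp hpC hq hqC h
        exact Or.inr ⟨p, hp, hap, hbq⟩
      · exact absurd (hs.pairCode_inj (hs.coreMate_mem hp hpC) (tag 1) (tag 0) (tag 2) hi).2
          (tne (by decide))
      · exact absurd (hs.pairCode_inj (tag 0) (tag 2) hqC (tag 0) hi).2 (tne (by decide))
      · exact absurd (hs.pairCode_inj (tag 0) (tag 2) (hs.coreMate_mem hq hqC) (tag 1) hi).2
          (tne (by decide))
      · exact Or.inl (hW a haW b hbW)
    intro i a b c ha hb hc
    rcases same i a b ha hb with h | ⟨p, hp, hap, hbp⟩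
    · exact Or.inl h
    · rcases same i a c ha hc with h | ⟨q, hq, haq, hcq⟩
      · exact Or.inr (Or.inl h)
      · obtain rfl := hs.mat.2 p hp q hq a hap haq
        obtain ⟨u, -, w, -, -, rfl⟩ := mem_twoSub.1 (hs.mat.1 p hp)
        rw [mem_upair] at hap hbp hcq
        grind
  · exact fun k i hi j hj => hs.sub _ (hs.pairCode_mem (hs.pairCode_mem hi hj) (tag k))
  · intro k k' i hi j hj i' hi' j' hj' h
    obtain ⟨h1, h2⟩ := hs.pairCode_inj (hs.pairCode_mem hi hj) (tag k) (hs.pairCode_mem hi' hj')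
        (tag k') h
    exact ⟨hτ h2, hs.pairCode_inj hi hj hi' hj' h1⟩
  · intro v hv
    rcases mem_cup.1 hv with hv | hv
    · obtain ⟨p, hp, hvp⟩ := mem_bigUnion.1 hv
      by_cases hpC : p ∈ stCore s
      · exact ⟨_, Or.inl ⟨p, hp, hvp, Or.inl ⟨hpC, rfl⟩⟩⟩
      · exact ⟨_, Or.inl ⟨p, hp, hvp, Or.inr ⟨hpC, rfl⟩⟩⟩
    · exact ⟨_, Or.inr ⟨hv, rfl⟩⟩

/-- If the first fresh edge is disjoint from `⋃ D` it is the new pair, and the second edge, about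
which nothing is known then, is not used. -/
theorem newPair_spec :
    newPair x e τ s ∈ twoSub x ∧ ∀ v ∈ newPair x e τ s, ¬ v ∈ bigUnion (stMatching s) := by
  obtain ⟨h1, h2⟩ := freshEdge_spec he hτ hs (W := empty)
    fun v hv => absurd hv (not_mem_empty v)
  have h2' : ¬ freshEdge e τ s empty ⊆ bigUnion (stMatching s) :=
    fun h => h2 fun v hv => mem_cup.2 (Or.inl (h v hv))
  rcases diff_twoSub h1 h2' with h | ⟨u, hu, h⟩
  · rcases pickPair_cases x (diff (freshEdge e τ s empty) (bigUnion (stMatching s)))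
      (diff (freshEdge e τ s (diff (freshEdge e τ s empty) (bigUnion (stMatching s))))
        (bigUnion (stMatching s)))
      with ⟨-, h'⟩ | ⟨h', -⟩
    · rw [newPair, h']
      exact ⟨h, fun v hv => (mem_diff.1 hv).2⟩
    · exact absurd h h'
  · obtain ⟨h3, h4⟩ := freshEdge_spec he hτ hs
      (W := diff (freshEdge e τ s empty) (bigUnion (stMatching s))) (by
        rw [h]
        intro v hv w hw
        rw [mem_single.1 hv, mem_single.1 hw])
    exact pickPair_spec h1 h2' h3 h4

end

/-! ### Appending a pair to a state -/

/-- The mate map of `s` is onto the core. -/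
def MateOnto (s : M) : Prop := ∀ c ∈ stCore s, ∃ p, opair p c ∈ stMate s

/-- The least element of the core that is not yet a mate. -/
noncomputable def nextCore (s : M) : M :=
  the fun c => c ∈ stCore s ∧ (¬ ∃ q, opair q c ∈ stMate s) ∧
    ∀ c' ∈ stCore s, (¬ ∃ q, opair q c' ∈ stMate s) → opair c c' ∈ stOrder s

/-- `s` with the pair `p` put at the end of its matching; the mate of `p` is `nextCore s`. -/
noncomputable def appendPair (s p : M) : M :=
  mkState (cup (stMatching s) (single p)) (stCore s)
    (cup (stOrder s) (prod (cup (stMatching s) (single p)) (single p))) (stPairing s)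
    (cup (stMate s) (single (opair p (nextCore s))))

instance {F : (ℕ → M) → M} [DefFun F] : DefPred (fun v => MateOnto (F v)) :=
  DefPred.comp₁ (R := MateOnto) (by unfold MateOnto; infer_instance)

instance {F : (ℕ → M) → M} [DefFun F] : DefFun (fun v => nextCore (F v)) :=
  DefFun.comp₁ (by unfold nextCore; infer_instance)

instance {F G : (ℕ → M) → M} [DefFun F] [DefFun G] : DefFun (fun v => appendPair (F v) (G v)) := by
  unfold appendPair; infer_instance

section
variable {x : M} {τ : Fin 5 → M} {s : M} (hs : IsState x τ s)
include hs

theorem IsState.nextCore_spec (h : ¬ MateOnto s) :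
    nextCore s ∈ stCore s ∧ ¬ ∃ q, opair q (nextCore s) ∈ stMate s := by
  unfold MateOnto at h
  push Not at h
  obtain ⟨c, hc, hcG⟩ := h
  obtain ⟨m, hm, hmin⟩ := hs.wo.2.2 (sep (stCore s) fun c => ¬ ∃ q, opair q c ∈ stMate s)
    (fun c hc => hs.sub c (mem_sep.1 hc).1) ⟨c, mem_sep.2 ⟨hc, by simpa using hcG⟩⟩
  obtain ⟨h1, h2⟩ := mem_sep.1 hm
  have : nextCore s = m := the_eq ⟨h1, h2, fun c' hc' hc'' => hmin c' (mem_sep.2 ⟨hc', hc''⟩)⟩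
    fun y hy => hs.wo.2.1 _ _ (hy.2.2 m h1 h2) (hmin y (mem_sep.2 ⟨hy.1, hy.2.1⟩))
  rw [this]
  exact ⟨h1, h2⟩

theorem IsState.not_mem_of_disjoint {p : M} (hp : p ∈ twoSub x)
    (hpD : ∀ v ∈ p, ¬ v ∈ bigUnion (stMatching s)) : ¬ p ∈ stMatching s := fun h => by
  obtain ⟨v, hv⟩ := twoSub_ne_empty hp
  exact hpD v hv (mem_bigUnion.2 ⟨p, h, hv⟩)

theorem IsState.isState_appendPair {p : M} (h : ¬ MateOnto s) (hp : p ∈ twoSub x)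
    (hpD : ∀ v ∈ p, ¬ v ∈ bigUnion (stMatching s)) : IsState x τ (appendPair s p) := by
  have hpD' := hs.not_mem_of_disjoint hp hpD
  obtain ⟨hc, hc'⟩ := hs.nextCore_spec h
  have hGD : ∀ a b, opair a b ∈ stMate s → a ∈ stMatching s ∧ ¬ a ∈ stCore s ∧ b ∈ stCore s := by
    intro a b hab
    have h := opair_mem_prod.1 (hs.inj.sub _ hab)
    exact ⟨(mem_diff.1 h.1).1, (mem_diff.1 h.1).2, h.2⟩
  constructor
  · simp [appendPair]
  · simp only [appendPair, stMatching_mk]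
    refine ⟨fun q hq => ?_, fun q hq r hr v hvq hvr => ?_⟩
    · rcases mem_cup.1 hq with hq | hq
      · exact hs.mat.1 q hq
      · rwa [mem_single.1 hq]
    · rw [mem_cup, mem_single] at hq hr
      rcases hq with hq | rfl <;> rcases hr with hr | rfl
      · exact hs.mat.2 q hq r hr v hvq hvr
      · exact absurd (mem_bigUnion.2 ⟨q, hq, hvq⟩) (hpD v hvr)
      · exact absurd (mem_bigUnion.2 ⟨r, hr, hvr⟩) (hpD v hvq)
      · rfl
  · simp only [appendPair, stMatching_mk, stOrder_mk]
    have hRD : ∀ a b, opair a b ∈ stOrder s → a ∈ stMatching s ∧ b ∈ stMatching s := fun a b hab =>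
      opair_mem_prod.1 (hs.wo.1 _ hab)
    refine ⟨fun q hq => ?_, fun a b hab hba => ?_, fun X hX hne => ?_⟩
    · rcases mem_cup.1 hq with hq | hq
      · exact prod_mono (fun _ h => mem_cup.2 (Or.inl h)) (fun _ h => mem_cup.2 (Or.inl h)) q
          (hs.wo.1 q hq)
      · exact prod_mono (fun _ h => h) (fun _ h => mem_cup.2 (Or.inr h)) q hq
    · simp only [mem_cup, opair_mem_prod, mem_single] at hab hba
      rcases hab with hab | ⟨-, rfl⟩ <;> rcases hba with hba | ⟨-, rfl⟩
      · exact hs.wo.2.1 a b hab hba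
      · exact absurd (hRD _ _ hab).1 hpD'
      · exact absurd (hRD _ _ hba).1 hpD'
      · rfl
    · by_cases hX' : ∃ q ∈ X, q ∈ stMatching s
      · obtain ⟨q, hq, hqD⟩ := hX'
        obtain ⟨m, hm, hmin⟩ := hs.wo.2.2 (sep X fun q => q ∈ stMatching s)
          (fun q hq => (mem_sep.1 hq).2) ⟨q, mem_sep.2 ⟨hq, hqD⟩⟩
        obtain ⟨hm1, hm2⟩ := mem_sep.1 hm
        refine ⟨m, hm1, fun b hb => ?_⟩
        rcases mem_cup.1 (hX b hb) with hbD | hbp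
        · exact mem_cup.2 (Or.inl (hmin b (mem_sep.2 ⟨hb, hbD⟩)))
        · exact mem_cup.2 (Or.inr (opair_mem_prod.2 ⟨mem_cup.2 (Or.inl hm2), hbp⟩))
      · have hXp : ∀ q ∈ X, q = p := fun q hq => by
          rcases mem_cup.1 (hX q hq) with h | h
          · exact absurd ⟨q, hq, h⟩ hX'
          · exact mem_single.1 h
        obtain ⟨q, hq⟩ := hne
        refine ⟨q, hq, fun b hb => ?_⟩
        rw [hXp q hq, hXp b hb]
        simp
  · simp only [appendPair, stMatching_mk, stCore_mk]
    exact fun q hq => mem_cup.2 (Or.inl (hs.sub q hq))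
  · simpa only [appendPair, stCore_mk] using hs.tag
  · simpa only [appendPair, stCore_mk, stPairing_mk] using hs.pairing
  · simp only [appendPair, stCore_mk, stMatching_mk, stMate_mk]
    refine ⟨fun q hq => ?_, fun a ha => ?_, fun a b c hab hac => ?_, fun a b c hac hbc => ?_⟩
    · rcases mem_cup.1 hq with hq | hq
      · refine prod_mono (fun q hq => ?_) (fun _ h => h) q (hs.inj.sub q hq)
        rw [mem_diff] at hq ⊢
        exact ⟨mem_cup.2 (Or.inl hq.1), hq.2⟩
      · rw [mem_single.1 hq, opair_mem_prod]
        exact ⟨mem_diff.2 ⟨by simp, fun h => hpD' (hs.sub p h)⟩, hc⟩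
    · obtain ⟨ha, haC⟩ := mem_diff.1 ha
      rcases mem_cup.1 ha with ha | ha
      · obtain ⟨b, hb⟩ := hs.inj.total a (mem_diff.2 ⟨ha, haC⟩)
        exact ⟨b, mem_cup.2 (Or.inl hb)⟩
      · exact ⟨nextCore s, by simp [mem_single.1 ha]⟩
    · simp only [mem_cup, mem_single, opair_inj] at hab hac
      rcases hab with hab | ⟨rfl, rfl⟩ <;> rcases hac with hac | ⟨h1, rfl⟩
      · exact hs.inj.func _ _ _ hab hac
      · exact absurd (h1 ▸ (hGD _ _ hab).1) hpD'
      · exact absurd (hGD _ _ hac).1 hpD'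
      · rfl
    · simp only [mem_cup, mem_single, opair_inj] at hac hbc
      rcases hac with hac | ⟨rfl, rfl⟩ <;> rcases hbc with hbc | ⟨h1, h2⟩
      · exact hs.inj.inj _ _ _ hac hbc
      · exact absurd ⟨a, h2 ▸ hac⟩ hc'
      · exact absurd ⟨b, hbc⟩ hc'
      · exact h1.symm

theorem IsState.le_appendPair {p : M} (hp : p ∈ twoSub x)
    (hpD : ∀ v ∈ p, ¬ v ∈ bigUnion (stMatching s)) : StateLE s (appendPair s p) := by
  have hpD' := hs.not_mem_of_disjoint hp hpD
  constructor <;> simp only [appendPair, stMatching_mk, stCore_mk, stOrder_mk, stPairing_mk,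
    stMate_mk]
  · exact fun q hq => mem_cup.2 (Or.inl hq)
  · exact fun q hq => mem_cup.2 (Or.inl hq)
  · intro a b hb hab
    simp only [mem_cup, opair_mem_prod, mem_single] at hab
    rcases hab with hab | ⟨-, rfl⟩
    · exact hab
    · exact absurd hb hpD'
  · exact fun q hq => hq
  · exact fun q hq => hq
  · exact Or.inl ⟨trivial, fun q hq => mem_cup.2 (Or.inl hq)⟩

end

/-! ### Promoting the matching to the core -/

/-- The pairing `(a, b) ↦ c` on the whole matching of a state whose mate map is onto the core. On
the core it is the old pairing. Otherwise `c` is the pair whose mate is the old code of `(a, b)`,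
formed with mates in place of elements outside the core and tagged by which of `a`, `b` are
outside. As `c` is then outside the core, these values differ from the old ones. -/
def PromoteRel (τ : Fin 5 → M) (s a b c : M) : Prop :=
  (a ∈ stCore s ∧ b ∈ stCore s ∧ opair (opair a b) c ∈ stPairing s) ∨
  (a ∈ stCore s ∧ ¬ b ∈ stCore s ∧ opair c (pairCode s (pairCode s a (coreMate s b)) (τ 0))
      ∈ stMate s) ∨
  (¬ a ∈ stCore s ∧ b ∈ stCore s ∧ opair c (pairCode s (pairCode s (coreMate s a) b) (τ 1))
      ∈ stMate s) ∨
  (¬ a ∈ stCore s ∧ ¬ b ∈ stCore s ∧ opair c (pairCode s (pairCode s (coreMate s a) (coreMate s b))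
      (τ 2)) ∈ stMate s)

/-- The graph of `PromoteRel`. -/
noncomputable def promotePairing (τ : Fin 5 → M) (s : M) : M :=
  sep (prod (prod (stMatching s) (stMatching s)) (stMatching s)) fun q =>
    ∃ a b c, q = opair (opair a b) c ∧ PromoteRel τ s a b c

/-- `s` with its whole matching as the core. -/
noncomputable def promote (τ : Fin 5 → M) (s : M) : M :=
  mkState (stMatching s) (stMatching s) (stOrder s) (promotePairing τ s) empty

instance {τ : Fin 5 → M} {F : (ℕ → M) → M} [DefFun F] : DefFun (fun v => promotePairing τ (F v)) :=
  DefFun.comp₁ (by unfold promotePairing PromoteRel; infer_instance)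

instance {τ : Fin 5 → M} {F : (ℕ → M) → M} [DefFun F] : DefFun (fun v => promote τ (F v)) := by
  unfold promote; infer_instance

instance {τ : Fin 5 → M} {s : M} {F G H : (ℕ → M) → M} [DefFun F] [DefFun G] [DefFun H] :
    DefPred (fun v => PromoteRel τ s (F v) (G v) (H v)) :=
  DefPred.comp₃ (by unfold PromoteRel; infer_instance)

theorem mem_promotePairing {τ : Fin 5 → M} {s a b c : M} :
    opair (opair a b) c ∈ promotePairing τ s ↔
    (a ∈ stMatching s ∧ b ∈ stMatching s ∧ c ∈ stMatching s) ∧ PromoteRel τ s a b c := by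
  rw [promotePairing, mem_sep, opair_mem_prod, opair_mem_prod, and_assoc (a := a ∈ stMatching s)]
  refine and_congr_right fun _ => ⟨?_, fun h => ⟨a, b, c, rfl, h⟩⟩
  rintro ⟨a', b', c', he, h⟩
  obtain ⟨hab, rfl⟩ := opair_inj.1 he
  obtain ⟨rfl, rfl⟩ := opair_inj.1 hab
  exact h

section
variable {x : M} {τ : Fin 5 → M} (hτ : Function.Injective τ) {s : M} (hs : IsState x τ s)
include hs

theorem IsState.mate_dom {a b : M} (hab : opair a b ∈ stMate s) :
    a ∈ stMatching s ∧ ¬ a ∈ stCore s ∧ b ∈ stCore s := by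
  have h := opair_mem_prod.1 (hs.inj.sub _ hab)
  exact ⟨(mem_diff.1 h.1).1, (mem_diff.1 h.1).2, h.2⟩

theorem IsState.pairing_dom {a b c : M} (h : opair (opair a b) c ∈ stPairing s) :
    a ∈ stCore s ∧ b ∈ stCore s ∧ c ∈ stCore s := by
  have h := opair_mem_prod.1 (hs.pairing.sub _ h)
  have h' := opair_mem_prod.1 h.1
  exact ⟨h'.1, h'.2, h.2⟩

include hτ

theorem IsState.promotePairing_isInjFun (h : MateOnto s) :
    IsInjFun (promotePairing τ s) (prod (stMatching s) (stMatching s)) (stMatching s) := by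
  have tne : ∀ {k l : Fin 5}, k ≠ l → τ k ≠ τ l := fun h h' => h (hτ h')
  have tag := hs.tag
  refine ⟨fun q hq => (mem_sep.1 hq).1, fun q hq => ?_, fun q c c' h1 h2 => ?_,
    fun q q' c h1 h2 => ?_⟩
  · obtain ⟨a, ha, b, hb, rfl⟩ := mem_prod.1 hq
    by_cases haC : a ∈ stCore s <;> by_cases hbC : b ∈ stCore s
    · obtain ⟨c, hc⟩ := hs.pairing.total (opair a b) (opair_mem_prod.2 ⟨haC, hbC⟩)
      exact ⟨c, mem_promotePairing.2 ⟨⟨ha, hb, hs.sub c (hs.pairing_dom hc).2.2⟩, Or.inl ⟨haC, hbC,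
          hc⟩⟩⟩
    · obtain ⟨c, hc⟩ := h _ (hs.pairCode_mem (hs.pairCode_mem haC (hs.coreMate_mem hb hbC)) (tag 0))
      exact ⟨c, mem_promotePairing.2 ⟨⟨ha, hb, (hs.mate_dom hc).1⟩, Or.inr (Or.inl ⟨haC, hbC, hc⟩)⟩⟩
    · obtain ⟨c, hc⟩ := h _ (hs.pairCode_mem (hs.pairCode_mem (hs.coreMate_mem ha haC) hbC) (tag 1))
      exact ⟨c, mem_promotePairing.2 ⟨⟨ha, hb, (hs.mate_dom hc).1⟩,
        Or.inr (Or.inr (Or.inl ⟨haC, hbC, hc⟩))⟩⟩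
    · obtain ⟨c, hc⟩ := h _
        (hs.pairCode_mem (hs.pairCode_mem (hs.coreMate_mem ha haC) (hs.coreMate_mem hb hbC))
            (tag 2))
      exact ⟨c, mem_promotePairing.2 ⟨⟨ha, hb, (hs.mate_dom hc).1⟩,
        Or.inr (Or.inr (Or.inr ⟨haC, hbC, hc⟩))⟩⟩
  · obtain ⟨a, ha, b, hb, rfl⟩ := mem_prod.1 (opair_mem_prod.1 ((mem_sep.1 h1).1)).1
    obtain ⟨-, h1⟩ := mem_promotePairing.1 h1
    obtain ⟨-, h2⟩ := mem_promotePairing.1 h2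
    rcases h1 with ⟨k1, k2, h1⟩ | ⟨k1, k2, h1⟩ | ⟨k1, k2, h1⟩ | ⟨k1, k2, h1⟩ <;>
      rcases h2 with ⟨l1, l2, h2⟩ | ⟨l1, l2, h2⟩ | ⟨l1, l2, h2⟩ | ⟨l1, l2, h2⟩ <;>
      first
      | exact absurd k1 l1
      | exact absurd l1 k1
      | exact absurd k2 l2
      | exact absurd l2 k2
      | exact hs.pairing.func _ _ _ h1 h2
      | exact hs.inj.inj _ _ _ h1 h2
  · obtain ⟨a, ha, b, hb, rfl⟩ := mem_prod.1 (opair_mem_prod.1 ((mem_sep.1 h1).1)).1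
    obtain ⟨a', ha', b', hb', rfl⟩ := mem_prod.1 (opair_mem_prod.1 ((mem_sep.1 h2).1)).1
    obtain ⟨-, h1⟩ := mem_promotePairing.1 h1
    obtain ⟨-, h2⟩ := mem_promotePairing.1 h2
    -- the value decides which of the four cases applies
    have g := fun p (hp : p ∈ stMatching s) (hp' : ¬ p ∈ stCore s) => hs.coreMate_mem hp hp'
    have gi := fun p q hp hp' hq hq' => hs.coreMate_inj (a := p) (b := q) hp hp' hq hq'
    have hm := fun p q hp hq => hs.pairCode_mem (a := p) (b := q) hp hq
    have hi := fun p q p' q' hp hq hp' hq' h =>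
      hs.pairCode_inj (a := p) (b := q) (a' := p') (b' := q') hp hq hp' hq' h
    rcases h1 with ⟨k1, k2, h1⟩ | ⟨k1, k2, h1⟩ | ⟨k1, k2, h1⟩ | ⟨k1, k2, h1⟩ <;>
      rcases h2 with ⟨l1, l2, h2⟩ | ⟨l1, l2, h2⟩ | ⟨l1, l2, h2⟩ | ⟨l1, l2, h2⟩
    · exact hs.pairing.inj _ _ _ h1 h2
    · exact absurd (hs.pairing_dom h1).2.2 (hs.mate_dom h2).2.1
    · exact absurd (hs.pairing_dom h1).2.2 (hs.mate_dom h2).2.1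
    · exact absurd (hs.pairing_dom h1).2.2 (hs.mate_dom h2).2.1
    · exact absurd (hs.pairing_dom h2).2.2 (hs.mate_dom h1).2.1
    · obtain ⟨e1, -⟩ := hi _ _ _ _ (hm _ _ k1 (g b hb k2)) (tag 0) (hm _ _ l1 (g b' hb' l2))
        (tag 0) (hs.inj.func _ _ _ h1 h2)
      obtain ⟨rfl, e2⟩ := hi _ _ _ _ k1 (g b hb k2) l1 (g b' hb' l2) e1
      rw [gi _ _ hb k2 hb' l2 e2]
    · exact absurd (hi _ _ _ _ (hm _ _ k1 (g b hb k2)) (tag 0) (hm _ _ (g a' ha' l1) l2)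
        (tag 1) (hs.inj.func _ _ _ h1 h2)).2 (tne (by decide))
    · exact absurd (hi _ _ _ _ (hm _ _ k1 (g b hb k2)) (tag 0)
        (hm _ _ (g a' ha' l1) (g b' hb' l2)) (tag 2) (hs.inj.func _ _ _ h1 h2)).2
        (tne (by decide))
    · exact absurd (hs.pairing_dom h2).2.2 (hs.mate_dom h1).2.1
    · exact absurd (hi _ _ _ _ (hm _ _ (g a ha k1) k2) (tag 1) (hm _ _ l1 (g b' hb' l2))
        (tag 0) (hs.inj.func _ _ _ h1 h2)).2 (tne (by decide))
    · obtain ⟨e1, -⟩ := hi _ _ _ _ (hm _ _ (g a ha k1) k2) (tag 1) (hm _ _ (g a' ha' l1) l2)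
        (tag 1) (hs.inj.func _ _ _ h1 h2)
      obtain ⟨e2, rfl⟩ := hi _ _ _ _ (g a ha k1) k2 (g a' ha' l1) l2 e1
      rw [gi _ _ ha k1 ha' l1 e2]
    · exact absurd (hi _ _ _ _ (hm _ _ (g a ha k1) k2) (tag 1)
        (hm _ _ (g a' ha' l1) (g b' hb' l2)) (tag 2) (hs.inj.func _ _ _ h1 h2)).2
        (tne (by decide))
    · exact absurd (hs.pairing_dom h2).2.2 (hs.mate_dom h1).2.1
    · exact absurd (hi _ _ _ _ (hm _ _ (g a ha k1) (g b hb k2)) (tag 2)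
        (hm _ _ l1 (g b' hb' l2)) (tag 0) (hs.inj.func _ _ _ h1 h2)).2 (tne (by decide))
    · exact absurd (hi _ _ _ _ (hm _ _ (g a ha k1) (g b hb k2)) (tag 2)
        (hm _ _ (g a' ha' l1) l2) (tag 1) (hs.inj.func _ _ _ h1 h2)).2 (tne (by decide))
    · obtain ⟨e1, -⟩ := hi _ _ _ _ (hm _ _ (g a ha k1) (g b hb k2)) (tag 2)
        (hm _ _ (g a' ha' l1) (g b' hb' l2)) (tag 2) (hs.inj.func _ _ _ h1 h2)
      obtain ⟨e2, e3⟩ := hi _ _ _ _ (g a ha k1) (g b hb k2) (g a' ha' l1) (g b' hb' l2) e1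
      rw [gi _ _ ha k1 ha' l1 e2, gi _ _ hb k2 hb' l2 e3]

theorem IsState.isState_promote (h : MateOnto s) : IsState x τ (promote τ s) := by
  constructor
  · simp [promote]
  · simpa only [promote, stMatching_mk] using hs.mat
  · simpa only [promote, stMatching_mk, stOrder_mk] using hs.wo
  · simp only [promote, stMatching_mk, stCore_mk]
    exact fun q hq => hq
  · simp only [promote, stCore_mk]
    exact fun k => hs.sub _ (hs.tag k)
  · simpa only [promote, stCore_mk, stPairing_mk] using hs.promotePairing_isInjFun hτ h
  · simp only [promote, stCore_mk, stMatching_mk, stMate_mk]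
    refine ⟨fun q hq => absurd hq (not_mem_empty q), fun a ha => ?_,
      fun a b c hab => absurd hab (not_mem_empty _), fun a b c hab => absurd hab (not_mem_empty _)⟩
    exact absurd (mem_diff.1 ha).1 (mem_diff.1 ha).2

omit hτ in
theorem IsState.le_promote : StateLE s (promote τ s) := by
  constructor <;> simp only [promote, stMatching_mk, stCore_mk, stOrder_mk, stPairing_mk, stMate_mk]
  · exact fun q hq => hq
  · exact fun q hq => hq
  · exact fun a b _ h => h
  · exact hs.sub
  · intro q hq
    obtain ⟨p, hp, c, hc, rfl⟩ := mem_prod.1 (hs.pairing.sub q hq)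
    obtain ⟨a, ha, b, hb, rfl⟩ := mem_prod.1 hp
    exact mem_promotePairing.2 ⟨⟨hs.sub a ha, hs.sub b hb, hs.sub c hc⟩, Or.inl ⟨ha, hb, hq⟩⟩
  · exact Or.inr fun q hq => hq

end

/-! ### The contradiction -/

/-- One step of the construction: promote the matching if the mate map is onto the core, and
append a new pair otherwise. -/
noncomputable def step (x : M) (e : M → M) (τ : Fin 5 → M) (s : M) : M :=
  the fun t => (MateOnto s ∧ t = promote τ s) ∨ (¬ MateOnto s ∧ t = appendPair s (newPair x e τ s))

theorem step_promote {x : M} {e : M → M} {τ : Fin 5 → M} {s : M} (h : MateOnto s) :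
    step x e τ s = promote τ s :=
  the_eq (Or.inl ⟨h, rfl⟩) (by tauto)

theorem step_appendPair {x : M} {e : M → M} {τ : Fin 5 → M} {s : M} (h : ¬ MateOnto s) :
    step x e τ s = appendPair s (newPair x e τ s) :=
  the_eq (Or.inr ⟨h, rfl⟩) (by tauto)

/-- The states would form a partially ordered set in which chains have suprema, with an
inflationary map `step` that has no fixed point. -/
theorem MatchingInj.false {x : M} {e : M → M} (he : MatchingInj x e) : False := by
  obtain ⟨D, R, f, τ, hτ, hτD, hD, hR, hf⟩ := he.exists_base
  have hbase : IsState x τ (mkState D D R f empty) := by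
    constructor <;> simp only [stMatching_mk, stCore_mk, stOrder_mk, stPairing_mk, stMate_mk]
    · exact hD
    · exact hR
    · exact fun q hq => hq
    · exact hτD
    · exact hf
    · refine ⟨fun q hq => absurd hq (not_mem_empty q), fun a ha => ?_,
        fun a b c hab => absurd hab (not_mem_empty _),
        fun a b c hab => absurd hab (not_mem_empty _)⟩
      exact absurd (mem_diff.1 ha).1 (mem_diff.1 ha).2
  have iN : ∀ {A : (ℕ → M) → M} [DefFun A], DefFun (fun v => newPair x e τ (A v)) :=
    DefFun.comp₁ (definable_newPair he)
  have hmem : ∀ s ∈ states x τ, step x e τ s ∈ states x τ := by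
    intro s hs
    have hs := mem_states.1 hs
    by_cases h : MateOnto s
    · rw [step_promote h]
      exact mem_states.2 (hs.isState_promote hτ h)
    · rw [step_appendPair h]
      obtain ⟨h1, h2⟩ := newPair_spec he hτ hs
      exact mem_states.2 (hs.isState_appendPair h h1 h2)
  have hle : ∀ s ∈ states x τ, StateLE s (step x e τ s) := by
    intro s hs
    have hs := mem_states.1 hs
    by_cases h : MateOnto s
    · rw [step_promote h]
      exact hs.le_promote
    · rw [step_appendPair h]
      obtain ⟨h1, h2⟩ := newPair_spec he hτ hs
      exact hs.le_appendPair h1 h2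
  obtain ⟨s, hs, hfix⟩ := bourbaki_witt (P := states x τ) (a := mkState D D R f empty)
    (le := StateLE) (F := step x e τ) (Sup := stateSup x) definable_stateLE
    (by unfold step; infer_instance) (definable_stateSup x)
    (mem_states.2 hbase) (fun s _ => stateLE_refl s) (fun s _ t _ u _ h h' => stateLE_trans h h')
    (fun s hs t ht h h' => stateLE_antisymm (mem_states.1 hs) (mem_states.1 ht) h h')
    hmem hle
    (fun K hK => ⟨mem_states.2 hK.isState_sup, fun c hc => hK.le_sup hc, fun u _ h => hK.sup_le h⟩)
  have hs := mem_states.1 hs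
  by_cases h : MateOnto s
  -- promotion changes the state: the pair whose mate is the first tag lies outside the old core
  · rw [step_promote h] at hfix
    have hDC : stMatching s = stCore s := by
      conv_rhs => rw [← hfix]
      simp [promote]
    obtain ⟨p, hp⟩ := h _ (hs.tag 0)
    exact (hs.mate_dom hp).2.1 (hDC ▸ (hs.mate_dom hp).1)
  · rw [step_appendPair h] at hfix
    obtain ⟨h1, h2⟩ := newPair_spec he hτ hs
    refine hs.not_mem_of_disjoint h1 h2 ?_
    have hD' : stMatching s = cup (stMatching s) (single (newPair x e τ s)) := by
      conv_lhs => rw [← hfix]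
      simp [appendPair]
    rw [hD']
    simp

end

section
variable {M : Type} [setLang.Structure M] [hM : M ⊨ ZF] [Nonempty M]

/-! ### Permutations -/

/-- `f` is a permutation of `x`. -/
def IsPerm (x f : M) : Prop := IsInjFun f x x ∧ ∀ b ∈ x, ∃ a, opair a b ∈ f

instance {F G : (ℕ → M) → M} [DefFun F] [DefFun G] : DefPred (fun v => IsPerm (F v) (G v)) :=
  DefPred.comp₂ (by unfold IsPerm; infer_instance)

/-- The set of permutations of `x`. -/
noncomputable def perms (x : M) : M := sep (pow (prod x x)) fun f => IsPerm x f

theorem mem_perms {x f : M} : f ∈ perms x ↔ IsPerm x f := by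
  rw [perms, mem_sep, mem_pow, and_iff_right_iff_imp]
  exact fun h => h.1.sub

/-- The permutation of `x` that exchanges the two points of every pair in the matching `Z` and
fixes all other points. -/
noncomputable def swap (x Z : M) : M :=
  sep (prod x x) fun q => ∃ a b, q = opair a b ∧
    ((a ≠ b ∧ upair a b ∈ Z) ∨ (a = b ∧ ¬ a ∈ bigUnion Z))

instance {F G : (ℕ → M) → M} [DefFun F] [DefFun G] : DefFun (fun v => swap (F v) (G v)) :=
  DefFun.comp₂ (by unfold swap; infer_instance)

theorem opair_mem_swap {x Z a b : M} : opair a b ∈ swap x Z ↔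
    (a ∈ x ∧ b ∈ x) ∧ ((a ≠ b ∧ upair a b ∈ Z) ∨ (a = b ∧ ¬ a ∈ bigUnion Z)) := by
  rw [swap, mem_sep, opair_mem_prod]
  refine and_congr_right fun _ => ⟨?_, fun h => ⟨a, b, rfl, h⟩⟩
  rintro ⟨a', b', he, h⟩
  obtain ⟨rfl, rfl⟩ := opair_inj.1 he
  exact h

theorem opair_mem_swap_comm {x Z a b : M} (h : opair a b ∈ swap x Z) : opair b a ∈ swap x Z := by
  rw [opair_mem_swap] at h ⊢
  rw [upair_comm b a]
  rcases h with ⟨⟨ha, hb⟩, ⟨h1, h2⟩ | ⟨rfl, h2⟩⟩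
  · exact ⟨⟨hb, ha⟩, Or.inl ⟨h1.symm, h2⟩⟩
  · exact ⟨⟨hb, ha⟩, Or.inr ⟨rfl, h2⟩⟩

theorem IsMatching.swap_func {x Z : M} (hZ : IsMatching x Z) {a b c : M} (h1 : opair a b ∈ swap x Z)
    (h2 : opair a c ∈ swap x Z) : b = c := by
  rw [opair_mem_swap] at h1 h2
  rcases h1.2 with ⟨hab, h3⟩ | ⟨rfl, h3⟩ <;> rcases h2.2 with ⟨hac, h4⟩ | ⟨rfl, h4⟩
  · rcases upair_inj (hZ.2 _ h3 _ h4 a (by simp) (by simp)) with h | h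
    · exact h.2
    · exact absurd h.1 hac
  · exact absurd (mem_bigUnion.2 ⟨_, h3, by simp⟩) h4
  · exact absurd (mem_bigUnion.2 ⟨_, h4, by simp⟩) h3
  · rfl

theorem IsMatching.swap_total {x Z : M} (hZ : IsMatching x Z) {a : M} (ha : a ∈ x) :
    ∃ b, opair a b ∈ swap x Z := by
  by_cases h : a ∈ bigUnion Z
  · obtain ⟨p, hp, hap⟩ := mem_bigUnion.1 h
    obtain ⟨b, hb, c, hc, hbc, rfl⟩ := mem_twoSub.1 (hZ.1 p hp)
    rcases mem_upair.1 hap with rfl | rfl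
    · exact ⟨c, opair_mem_swap.2 ⟨⟨ha, hc⟩, Or.inl ⟨hbc, hp⟩⟩⟩
    · exact ⟨b, opair_mem_swap.2 ⟨⟨ha, hb⟩, Or.inl ⟨hbc.symm, upair_comm b a ▸ hp⟩⟩⟩
  · exact ⟨a, opair_mem_swap.2 ⟨⟨ha, ha⟩, Or.inr ⟨rfl, h⟩⟩⟩

theorem IsMatching.swap_mem {x Z : M} (hZ : IsMatching x Z) : swap x Z ∈ perms x := by
  refine mem_perms.2 ⟨⟨fun q hq => (mem_sep.1 hq).1, fun a ha => hZ.swap_total ha,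
    fun a b c h1 h2 => hZ.swap_func h1 h2, fun a b c h1 h2 =>
      hZ.swap_func (opair_mem_swap_comm h1) (opair_mem_swap_comm h2)⟩, fun b hb => ?_⟩
  obtain ⟨a, ha⟩ := hZ.swap_total hb
  exact ⟨a, opair_mem_swap_comm ha⟩

theorem IsMatching.sub_of_swap_eq {x Z Z' : M} (hZ : IsMatching x Z) (h : swap x Z = swap x Z') :
    Z ⊆ Z' := by
  intro p hp
  obtain ⟨a, ha, b, hb, hab, rfl⟩ := mem_twoSub.1 (hZ.1 p hp)
  have h1 : opair a b ∈ swap x Z' := h ▸ opair_mem_swap.2 ⟨⟨ha, hb⟩, Or.inl ⟨hab, hp⟩⟩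
  rcases (opair_mem_swap.1 h1).2 with h2 | h2
  · exact h2.2
  · exact absurd h2.1 hab

theorem IsMatching.swap_inj {x Z Z' : M} (hZ : IsMatching x Z) (hZ' : IsMatching x Z')
    (h : swap x Z = swap x Z') : Z = Z' :=
  subset_antisymm' (hZ.sub_of_swap_eq h) (hZ'.sub_of_swap_eq h.symm)

/-- The map `p ↦ swap x {p}` sends a two-element subset to the transposition of its elements. -/
theorem exists_inj_twoSub_perms (x : M) : ∃ f, IsInjFun f (twoSub x) (perms x) := by
  have hf : ∀ p q, opair p q ∈ sep (prod (twoSub x) (perms x))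
      (fun r => snd r = swap x (single (fst r))) ↔ p ∈ twoSub x ∧ q = swap x (single p) := by
    intro p q
    rw [mem_sep, opair_mem_prod, fst_opair, snd_opair]
    constructor
    · exact fun h => ⟨h.1.1, h.2⟩
    · rintro ⟨hp, rfl⟩
      exact ⟨⟨hp, (isMatching_single hp).swap_mem⟩, rfl⟩
  refine ⟨_, fun r hr => (mem_sep.1 hr).1, fun p hp => ⟨_, (hf _ _).2 ⟨hp, rfl⟩⟩,
    fun p q r h1 h2 => ?_, fun p q r h1 h2 => ?_⟩
  · rw [((hf _ _).1 h1).2, ((hf _ _).1 h2).2]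
  · obtain ⟨hp, rfl⟩ := (hf _ _).1 h1
    obtain ⟨hq, h⟩ := (hf _ _).1 h2
    have := (isMatching_single hp).swap_inj (isMatching_single hq) h
    exact mem_single.1 (this ▸ mem_single.2 rfl : p ∈ single q)

/-- Composing with `swap x` turns an injection of the permutations into one of the matchings. -/
theorem not_exists_inj_perms_twoSub (x : M) : ¬ ∃ f, IsInjFun f (perms x) (twoSub x) := by
  rintro ⟨f, hf⟩
  refine MatchingInj.false (x := x) (e := fun Z => app f (swap x Z)) ⟨inferInstance,
    fun Z hZ => hf.app_mem hZ.swap_mem, fun Z Z' hZ hZ' h => hZ.swap_inj hZ' ?_⟩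
  exact hf.app_inj hZ.swap_mem hZ'.swap_mem h

/-! ### Meaning of the formulas in a model -/

section
variable (v : Empty → M) {n : ℕ} (xs : Fin n → M)

theorem realize_isPair (p a b : Fin n) :
    (isPair p a b).Realize v xs ↔ xs p = upair (xs a) (xs b) := by
  simp only [isPair, BoundedFormula.realize_all, BoundedFormula.realize_iff,
    BoundedFormula.realize_sup, realize_mem, realize_eq, Fin.snoc_last, Fin.snoc_castSucc]
  constructor
  · exact fun h => ext_mem fun z => by rw [h z, mem_upair]
  · intro h z
    rw [h, mem_upair]

theorem realize_isOrderedPair (p a b : Fin n) :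
    (isOrderedPair p a b).Realize v xs ↔ xs p = opair (xs a) (xs b) := by
  simp only [isOrderedPair, BoundedFormula.realize_ex, BoundedFormula.realize_inf, realize_isPair,
    Fin.snoc_last, Fin.snoc_castSucc]
  constructor
  · rintro ⟨c, d, ⟨rfl, rfl⟩, h⟩
    exact h
  · exact fun h => ⟨_, _, ⟨rfl, rfl⟩, h⟩

theorem realize_maps (f a b : Fin n) :
    (maps f a b).Realize v xs ↔ opair (xs a) (xs b) ∈ xs f := by
  simp only [maps, BoundedFormula.realize_ex, BoundedFormula.realize_inf, realize_isOrderedPair,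
    realize_mem, Fin.snoc_last, Fin.snoc_castSucc]
  constructor
  · rintro ⟨c, rfl, h⟩
    exact h
  · exact fun h => ⟨_, rfl, h⟩

theorem realize_isInjection (f x y : Fin n) :
    (isInjection f x y).Realize v xs ↔ IsInjFun (xs f) (xs x) (xs y) := by
  simp only [isInjection, isFunction, BoundedFormula.realize_all, BoundedFormula.realize_ex,
    BoundedFormula.realize_inf, BoundedFormula.realize_imp, realize_isOrderedPair, realize_maps,
    realize_mem, realize_eq, Fin.snoc_last, Fin.snoc_castSucc]
  have hdom {a b : M} (h : ∀ p ∈ xs f, ∃ a b, (a ∈ xs x ∧ b ∈ xs y) ∧ p = opair a b)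
      (hab : opair a b ∈ xs f) : a ∈ xs x := by
    obtain ⟨a', b', ⟨ha, -⟩, he⟩ := h _ hab
    rw [(opair_inj.1 he).1]
    exact ha
  constructor
  · rintro ⟨⟨h1, h2⟩, h3⟩
    refine ⟨fun p hp => ?_, fun a ha => ?_, fun a b c hab hac => ?_,
      fun a b c hac hbc => h3 a b c ⟨hac, hbc⟩⟩
    · obtain ⟨a, b, ⟨ha, hb⟩, rfl⟩ := h1 p hp
      exact opair_mem_prod.2 ⟨ha, hb⟩
    · obtain ⟨b, hb, -⟩ := h2 a ha
      exact ⟨b, hb⟩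
    · obtain ⟨d, -, hd⟩ := h2 a (hdom h1 hab)
      rw [hd b hab, hd c hac]
  · intro h
    refine ⟨⟨fun p hp => ?_, fun a ha => ?_⟩, fun a b c hab => h.inj _ _ _ hab.1 hab.2⟩
    · obtain ⟨a, ha, b, hb, rfl⟩ := mem_prod.1 (h.sub p hp)
      exact ⟨a, b, ⟨ha, hb⟩, rfl⟩
    · obtain ⟨b, hb⟩ := h.total a ha
      exact ⟨b, hb, fun c hc => h.func _ _ _ hc hb⟩

theorem realize_isPermutation (f x : Fin n) :
    (isPermutation f x).Realize v xs ↔ IsPerm (xs x) (xs f) := by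
  simp only [isPermutation, IsPerm, BoundedFormula.realize_all, BoundedFormula.realize_ex,
    BoundedFormula.realize_inf, BoundedFormula.realize_imp, realize_isInjection, realize_maps,
    realize_mem, Fin.snoc_last, Fin.snoc_castSucc]

theorem realize_isSetOfPermutations (s x : Fin n) :
    (isSetOfPermutations s x).Realize v xs ↔ xs s = perms (xs x) := by
  simp only [isSetOfPermutations, BoundedFormula.realize_all, BoundedFormula.realize_iff,
    realize_isPermutation, realize_mem, Fin.snoc_last, Fin.snoc_castSucc]
  constructor
  · exact fun h => ext_mem fun z => (h z).trans mem_perms.symm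
  · intro h z
    rw [h, mem_perms]

theorem realize_isSetOfTwoElementSubsets (p x : Fin n) :
    (isSetOfTwoElementSubsets p x).Realize v xs ↔ xs p = twoSub (xs x) := by
  simp only [isSetOfTwoElementSubsets, BoundedFormula.realize_all, BoundedFormula.realize_iff,
    BoundedFormula.realize_ex, BoundedFormula.realize_inf, BoundedFormula.realize_not,
    realize_isPair, realize_mem, realize_eq, Fin.snoc_last, Fin.snoc_castSucc]
  have h2 (z : M) : (∃ a b, ((a ∈ xs x ∧ b ∈ xs x) ∧ ¬ a = b) ∧ z = upair a b) ↔
      z ∈ twoSub (xs x) := by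
    rw [mem_twoSub]
    constructor
    · rintro ⟨a, b, ⟨⟨ha, hb⟩, hab⟩, h⟩
      exact ⟨a, ha, b, hb, hab, h⟩
    · rintro ⟨a, ha, b, hb, hab, h⟩
      exact ⟨a, b, ⟨⟨ha, hb⟩, hab⟩, h⟩
  simp only [h2]
  exact ⟨fun h => ext_mem h, fun h z => by rw [h]⟩

theorem realize_cardLE (x y : Fin n) :
    (cardLE x y).Realize v xs ↔ ∃ f, IsInjFun f (xs x) (xs y) := by
  simp only [cardLE, BoundedFormula.realize_ex, realize_isInjection, Fin.snoc_last,
    Fin.snoc_castSucc]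

end
end
end SetTheoryZF

theorem mainTheorem2 : SetTheoryZF.ZF ⊨ᵇ SetTheoryZF.pairsLTFactorial := by
  intro M v xs
  simp only [SetTheoryZF.pairsLTFactorial, SetTheoryZF.cardLT,
    FirstOrder.Language.BoundedFormula.realize_all, FirstOrder.Language.BoundedFormula.realize_ex,
    FirstOrder.Language.BoundedFormula.realize_inf, FirstOrder.Language.BoundedFormula.realize_not,
    SetTheoryZF.realize_isSetOfTwoElementSubsets, SetTheoryZF.realize_isSetOfPermutations,
    SetTheoryZF.realize_cardLE]
  intro x
  exact ⟨SetTheoryZF.twoSub x, SetTheoryZF.perms x, ⟨rfl, rfl⟩,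
    SetTheoryZF.exists_inj_twoSub_perms x, SetTheoryZF.not_exists_inj_perms_twoSub x⟩
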